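/- Let $a>0$, let $K=L^2((0,\infty),dt)$ (complex-valued functions), and let $\mathcal F_+(f)(u)=2\int_0^\infty\cos(2\pi tu)f(t)\,dt$ be the (unitary) cosine transform on $K$. Let $L_a\subset K$ be the space of those $f\in K$ such that both $f$ and $\mathcal F_+(f)$ are almost everywhere constant on $(0,a)$. For $f\in K$ let $\widehat f(s)=\int_0^\infty f(t)t^{-s}\,dt$, $\operatorname{Re}(s)=\frac12$, be its right Mellin transform (the integral being the limit in $L^2$ of the critical line of the integrals over $(1/T,T)$, $T\to\infty$). Then for each $f\in L_a$ the function $\widehat f$ is (almost everywhere) the restriction to the critical line of a meromorphic function $G$ on $\mathbb C$. Let $\widehat{L_a}$ be the set of all meromorphic functions on $\mathbb C$ obtained in this way. Every $G\in\widehat{L_a}$ has the L-Property: $G$ has at most finitely many poles in $\mathbb C$, and for all real $\alpha\le\beta$ and all $\epsilon>0$, $\delta>0$ there is a constant $C$ (depending on $G,\alpha,\beta,\epsilon,\delta$) such that $$|G(\sigma+i\tau)|\le C\,(1+|\tau|)^{(\frac12-\alpha)^++\epsilon}$$ whenever $\alpha\le\sigma\le\beta$ and $\sigma+i\tau$ is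 at distance at least $\delta$ from every pole of $G$; here $x^+=\max(x,0)$. In particular, the Lindelöf exponent $\mu_G(\sigma)=\inf\{\xi\in\mathbb R: G(\sigma+i\tau)=O(|\tau|^\xi)\text{ as }|\tau|\to\infty\}\in[-\infty,\infty]$ satisfies $\mu_G(\sigma)\le 0$ for $\sigma\ge\frac12$ and $\mu_G(\sigma)\le\frac12-\sigma$ for $\sigma\le\frac12$. -/

import Mathlib

open MeasureTheory Filter Set Asymptotics
open scoped Topology ENNReal FourierTransform

namespace Sonine

/-- The Hilbert space `K = L²((0, ∞), dt)` of complex-valued square-integrable functions. -/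
abbrev K : Type := Lp ℂ 2 (volume.restrict (Ioi (0 : ℝ)))

/-- The even extension `t ↦ f(|t|)` of an element of `K` is square-integrable on `ℝ`. -/
theorem memLp_even (f : K) : MemLp (fun t : ℝ => (f : ℝ → ℂ) |t|) 2 volume := by
  have hf : MemLp (f : ℝ → ℂ) 2 (volume.restrict (Ioi (0 : ℝ))) := Lp.memLp f
  have h1 : MemLp (fun t : ℝ => (f : ℝ → ℂ) |t|) 2 (volume.restrict (Ioi (0 : ℝ))) := by
    refine hf.ae_eq ?_
    filter_upwards [ae_restrict_mem measurableSet_Ioi] with t ht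
    rw [abs_of_pos ht]
  have hmp : MeasurePreserving (fun t : ℝ => -t) (volume.restrict (Iio (0 : ℝ)))
      (volume.restrict (Ioi (0 : ℝ))) := by
    have := (Measure.measurePreserving_neg (volume : Measure ℝ)).restrict_preimage
      (measurableSet_Ioi (a := (0 : ℝ)))
    simpa using this
  have h2 : MemLp (fun t : ℝ => (f : ℝ → ℂ) |t|) 2 (volume.restrict (Iio (0 : ℝ))) := by
    have := h1.comp_measurePreserving hmp
    simpa [Function.comp_def] using this
  have h2' : MemLp (fun t : ℝ => (f : ℝ → ℂ) |t|) 2 (volume.restrict (Ioi (0 : ℝ))ᶜ) := by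
    rwa [compl_Ioi, ← restrict_Iio_eq_restrict_Iic]
  classical
  have h3 := MemLp.piecewise measurableSet_Ioi h1 h2'
  simpa using h3

/-- The even extension of `f ∈ K`, as an element of `L²(ℝ)`. -/
noncomputable def evenExt (f : K) : Lp ℂ 2 (volume : Measure ℝ) := (memLp_even f).toLp _

/-- The cosine transform `(𝓕₊ f)(u) = 2 ∫₀^∞ cos(2πtu) f(t) dt` on `K` (in the `L²` sense):
the restriction to `(0, ∞)` of the `L²(ℝ)` Fourier transform of the even extension of `f`. -/
noncomputable def cosineTransform (f : K) : K :=
  ((Lp.memLp (𝓕 (evenExt f))).restrict (Ioi (0 : ℝ))).toLp _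

/-- `f` is (almost everywhere) constant on `(0, a)`. -/
def ConstantOn (f : K) (a : ℝ) : Prop :=
  ∃ c : ℂ, ∀ᵐ t ∂(volume.restrict (Ioo (0 : ℝ) a)), (f : ℝ → ℂ) t = c

/-- The extended Sonine space `L_a`: the functions in `K` which are constant on `(0, a)` and
whose cosine transform is constant on `(0, a)`. -/
def L (a : ℝ) : Set K := {f | ConstantOn f a ∧ ConstantOn (cosineTransform f) a}

/-- `G` restricts on the critical line to the right Mellin transform
`f^(s) = ∫₀^∞ f(t) t^(-s) dt` of `f ∈ K`, the integral being the limit in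
`L²(Re s = 1/2)` of the integrals over `(1/T, T)` as `T → ∞`. -/
def IsMellinTransform (f : K) (G : ℂ → ℂ) : Prop :=
  MemLp (fun τ : ℝ => G (1 / 2 + τ * Complex.I)) 2 volume ∧
  Tendsto (fun T : ℝ => eLpNorm (fun τ : ℝ => G (1 / 2 + τ * Complex.I) -
      ∫ t in Ioo T⁻¹ T, (f : ℝ → ℂ) t * (t : ℂ) ^ (-(1 / 2 + τ * Complex.I) : ℂ)) 2 volume)
    atTop (𝓝 0)

/-- The poles of `F`. -/
def poles (F : ℂ → ℂ) : Set ℂ := {s | meromorphicOrderAt F s < 0}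

/-- `F` is a meromorphic function on `ℂ`, holomorphic at each point that is not a pole (i.e.
no removable singularity is left unfilled). The values of `F` at its poles are irrelevant. -/
def IsMeromorphicFunction (F : ℂ → ℂ) : Prop :=
  Meromorphic F ∧ ∀ s, s ∉ poles F → AnalyticAt ℂ F s

/-- The Mellin image of `L_a`: the right Mellin transforms of the elements of `L_a`, viewed as
meromorphic functions in the complex plane. -/
def mellinImage (a : ℝ) : Set (ℂ → ℂ) :=
  {G | IsMeromorphicFunction G ∧ ∃ f ∈ L a, IsMellinTransform f G}

/-- The L-Property: `F` is analytic in `ℂ` with at most finitely many poles, and for all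
`α ≤ β` and `ε > 0`, `F(σ+iτ) = O((1+|τ|)^((1/2-α)⁺+ε))` on `α ≤ σ ≤ β` away from the poles
(i.e. outside the discs of any fixed radius `δ > 0` around the poles). -/
def LProperty (F : ℂ → ℂ) : Prop :=
  IsMeromorphicFunction F ∧ (poles F).Finite ∧
  ∀ α β ε δ : ℝ, α ≤ β → 0 < ε → 0 < δ → ∃ C : ℝ, ∀ s : ℂ, α ≤ s.re → s.re ≤ β →
    (∀ p ∈ poles F, δ ≤ ‖s - p‖) → ‖F s‖ ≤ C * (1 + |s.im|) ^ (max (1 / 2 - α) 0 + ε)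

/-- The Lindelöf exponent `μ_F(σ) ∈ [-∞, ∞]`: the infimum of the real `ξ` such that
`F(σ+iτ) = O(|τ|^ξ)` as `|τ| → ∞`. -/
noncomputable def lindelofExponent (F : ℂ → ℂ) (σ : ℝ) : EReal :=
  sInf ((fun ξ : ℝ => (ξ : EReal)) ''
    {ξ : ℝ | (fun τ : ℝ => F (σ + τ * Complex.I)) =O[cocompact ℝ] fun τ : ℝ => |τ| ^ ξ})

end Sonine

/-! Write γ(s) = ½π^(-s/2)Γ(s/2+1), and test f against the dilates of Riemann's kernel φ, a
self-dual Schwartz function with Mellin transform (s-1)γ(s). By Parseval, Θ_f(x) = ∫φ(tx)f(t)dt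
satisfies Θ_f(1/x) = xΘ_g(x), where g is the cosine transform of f (`theta_one_div`). If f = c on
(0, a), that interval contributes a Gaussian-small term, since φ has an explicit Gaussian primitive
vanishing at 0, and on the rest φ is evaluated only beyond ax. So Θ_f decays faster than every power
at infinity (`theta_isBigO`), and constancy of g gives the same at 0. Its Mellin transform is
therefore entire, bounded in vertical strips, and exchanged with that of Θ_g under s ↦ 1-s.

For Re s > 1/2, Fubini evaluates this transform as γ(s)((s-1)∫ₐ^∞ f(t)t^(-s)dt - c·a^(1-s))
(`mellin_theta`). Since 1/γ is entire, division by γ(s)(s-1) yields a meromorphic function whose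
only possible pole is s = 1.

Growth: the formula bounds the function on Re s = 1/2+η. The functional equation and the size of
γ(1-s)/γ(s) bound it by |τ|^n on Re s = 1/2-n. Phragmén–Lindelöf interpolates
(`exists_convexity_bound`), and a small η costs only ε in the exponent.

Identification: for 1/2 < Re s < 1 the continuation is a convergent Mellin integral of f, that is, a
Fourier transform in u = -log t. Plancherel lets Re s decrease to 1/2 in L²
(`isMellinTransform_mellinContinuation`). Finally, meromorphic functions agreeing almost everywhere
on the critical line coincide (`eventuallyEq_of_ae_eq_line`), so every member of `mellinImage a`
inherits the bounds. -/

namespace Sonine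

/-! ### The L² Fourier transform: agreement with the integral, Parseval, parity. -/

/-- The `L²` Fourier transform of an integrable square-integrable function is given by the Fourier
integral. -/
theorem fourier_toLp_ae_eq {g : ℝ → ℂ} (h1 : Integrable g) (h2 : MemLp g 2 volume) :
    (𝓕 (h2.toLp g) : Lp ℂ 2 (volume : Measure ℝ)) =ᵐ[volume] 𝓕 g := by
  have hcont : Continuous (𝓕 g) :=
    VectorFourier.fourierIntegral_continuous Real.continuous_fourierChar
      (by exact continuous_inner) h1
  have hloc : LocallyIntegrable
      (fun x => (𝓕 (h2.toLp g) : Lp ℂ 2 (volume : Measure ℝ)) x - 𝓕 g x) volume :=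
    ((Lp.memLp _).locallyIntegrable (by norm_num)).sub hcont.locallyIntegrable
  -- Both transforms are compared as distributions: against a test function, the transform moves
  -- onto the test function, by the tempered-distribution identity for the L² one and by Fubini for
  -- the integral one.
  have key : ∀ᵐ x, (𝓕 (h2.toLp g) : Lp ℂ 2 (volume : Measure ℝ)) x - 𝓕 g x = 0 := by
    refine ae_eq_zero_of_integral_contDiff_smul_eq_zero hloc ?_
    intro u hu hcs
    have hu' : ContDiff ℝ (⊤ : ℕ∞) (fun x => (u x : ℂ)) :=
      Complex.ofRealCLM.contDiff.comp hu
    have hcs' : HasCompactSupport (fun x => (u x : ℂ)) :=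
      hcs.comp_left (g := fun y : ℝ => (y : ℂ)) (by simp)
    let φ : SchwartzMap ℝ ℂ := hcs'.toSchwartzMap hu'
    have hφ : ∀ x, φ x = (u x : ℂ) := fun x => rfl
    have e1 := congrArg (fun T => T φ)
      (MeasureTheory.Lp.fourier_toTemperedDistribution_eq (h2.toLp g))
    simp only [TemperedDistribution.fourier_apply, Lp.toTemperedDistribution_apply] at e1
    have e2 : ∫ x, (𝓕 φ) x • (h2.toLp g : ℝ → ℂ) x = ∫ x, (𝓕 φ) x • g x := by
      refine integral_congr_ae ?_
      filter_upwards [h2.coeFn_toLp] with x hx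
      rw [hx]
    have e3 : ∫ x, (𝓕 φ) x • g x = ∫ x, φ x • (𝓕 g) x := by
      rw [SchwartzMap.fourier_coe]
      have := VectorFourier.integral_fourierIntegral_smul_eq_flip (L := innerₗ ℝ)
        (μ := volume) (ν := volume) (f := (φ : ℝ → ℂ)) (g := g)
        Real.continuous_fourierChar (by exact continuous_inner) φ.integrable h1
      rw [flip_innerₗ] at this
      exact this
    have i1 : Integrable (fun x => φ x • (𝓕 (h2.toLp g) : Lp ℂ 2 (volume : Measure ℝ)) x) := by
      have : MemLp (fun x => φ x • (𝓕 (h2.toLp g) : Lp ℂ 2 (volume : Measure ℝ)) x) 1 volume :=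
        (Lp.memLp (𝓕 (h2.toLp g) : Lp ℂ 2 (volume : Measure ℝ))).smul (φ.memLp 2)
      exact memLp_one_iff_integrable.1 this
    have i2 : Integrable (fun x => φ x • (𝓕 g) x) := by
      refine φ.integrable.smul_bdd (∫ v, ‖g v‖) hcont.aestronglyMeasurable ?_
      exact Eventually.of_forall fun x =>
        VectorFourier.norm_fourierIntegral_le_integral_norm _ _ _ g x
    calc ∫ x, u x • ((𝓕 (h2.toLp g) : Lp ℂ 2 (volume : Measure ℝ)) x - 𝓕 g x)
        = ∫ x, (φ x • (𝓕 (h2.toLp g) : Lp ℂ 2 (volume : Measure ℝ)) x - φ x • 𝓕 g x) := by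
          refine integral_congr_ae (Eventually.of_forall fun x => ?_)
          simp only [hφ]
          simp [smul_sub]
      _ = 0 := by
          rw [integral_sub i1 i2, ← e1, e2, e3, sub_self]
  filter_upwards [key] with x hx
  exact sub_eq_zero.1 hx

/-- Parseval's identity for an `L²` function and an integrable square-integrable function. -/
theorem integral_conj_fourier_mul {g : ℝ → ℂ} (h1 : Integrable g) (h2 : MemLp g 2 volume)
    (F : Lp ℂ 2 (volume : Measure ℝ)) :
    ∫ x, (starRingEnd ℂ) (𝓕 g x) * (𝓕 F : Lp ℂ 2 (volume : Measure ℝ)) x =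
      ∫ x, (starRingEnd ℂ) (g x) * F x := by
  have h := MeasureTheory.Lp.inner_fourier_eq (h2.toLp g) F
  rw [L2.inner_def, L2.inner_def] at h
  have e1 : ∫ x, (starRingEnd ℂ) (𝓕 g x) * (𝓕 F : Lp ℂ 2 (volume : Measure ℝ)) x =
      ∫ x, inner ℂ ((𝓕 (h2.toLp g) : Lp ℂ 2 (volume : Measure ℝ)) x)
        ((𝓕 F : Lp ℂ 2 (volume : Measure ℝ)) x) := by
    refine integral_congr_ae ?_
    filter_upwards [fourier_toLp_ae_eq h1 h2] with x hx
    rw [hx, RCLike.inner_apply, mul_comm]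
  have e2 : ∫ x, (starRingEnd ℂ) (g x) * F x = ∫ x, inner ℂ ((h2.toLp g) x) (F x) := by
    refine integral_congr_ae ?_
    filter_upwards [h2.coeFn_toLp] with x hx
    rw [hx, RCLike.inner_apply, mul_comm]
  rw [e1, e2, h]

theorem fourier_comp_neg_apply (g : ℝ → ℂ) (x : ℝ) :
    𝓕 (fun t => g (-t)) x = 𝓕 g (-x) := by
  rw [Real.fourier_real_eq, Real.fourier_real_eq,
    ← integral_neg_eq_self (fun v => Real.fourierChar (-(v * -x)) • g v)]
  simp

/-- The `L²` Fourier transform commutes with the reflection `t ↦ -t`. -/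
theorem fourier_compMeasurePreserving_neg (F : Lp ℂ 2 (volume : Measure ℝ)) :
    (𝓕 (Lp.compMeasurePreserving (fun t : ℝ => -t) (Measure.measurePreserving_neg volume) F) :
        Lp ℂ 2 (volume : Measure ℝ)) =
      Lp.compMeasurePreserving (fun t : ℝ => -t) (Measure.measurePreserving_neg volume) (𝓕 F) := by
  have hmp : MeasurePreserving (fun t : ℝ => -t) volume volume :=
    Measure.measurePreserving_neg volume
  have hN : Continuous (fun F : Lp ℂ 2 (volume : Measure ℝ) =>
      Lp.compMeasurePreserving (fun t : ℝ => -t) hmp F) :=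
    (Lp.isometry_compMeasurePreserving (p := 2) hmp).continuous
  have hF : Continuous (fun F : Lp ℂ 2 (volume : Measure ℝ) =>
      (𝓕 F : Lp ℂ 2 (volume : Measure ℝ))) :=
    (MeasureTheory.Lp.fourierTransformₗᵢ ℝ ℂ).continuous
  -- Both sides are continuous in `F`, so it suffices to check Schwartz functions, where the
  -- transform is an integral.
  refine DenseRange.induction_on (p := fun F : Lp ℂ 2 (volume : Measure ℝ) =>
      (𝓕 (Lp.compMeasurePreserving (fun t : ℝ => -t) hmp F) : Lp ℂ 2 (volume : Measure ℝ)) =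
        Lp.compMeasurePreserving (fun t : ℝ => -t) hmp (𝓕 F))
    (SchwartzMap.denseRange_toLpCLM (p := 2) ENNReal.ofNat_ne_top) F
    (isClosed_eq (hF.comp hN) (hN.comp hF)) ?_
  intro φ
  have h2 : MemLp (fun t => φ (-t)) 2 volume := (φ.memLp 2).comp_measurePreserving hmp
  have h1 : Integrable (fun t => φ (-t)) := φ.integrable.comp_neg
  have e1 : Lp.compMeasurePreserving (fun t : ℝ => -t) hmp (SchwartzMap.toLpCLM ℝ ℂ 2 volume φ)
      = h2.toLp _ := by
    apply Lp.ext
    refine (Lp.coeFn_compMeasurePreserving _ hmp).trans (EventuallyEq.trans ?_ h2.coeFn_toLp.symm)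
    exact hmp.quasiMeasurePreserving.ae_eq (φ.coeFn_toLp 2 volume)
  rw [e1]
  apply Lp.ext
  refine (fourier_toLp_ae_eq h1 h2).trans
    (EventuallyEq.trans ?_ (Lp.coeFn_compMeasurePreserving _ hmp).symm)
  have e2 : (𝓕 (SchwartzMap.toLpCLM ℝ ℂ 2 volume φ) : Lp ℂ 2 (volume : Measure ℝ))
      =ᵐ[volume] 𝓕 (φ : ℝ → ℂ) := fourier_toLp_ae_eq φ.integrable (φ.memLp 2)
  have e3 := hmp.quasiMeasurePreserving.ae_eq e2
  refine EventuallyEq.trans (Eventually.of_forall fun x => ?_) e3.symm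
  exact fourier_comp_neg_apply _ x

theorem fourier_evenExt_neg (f : K) :
    ∀ᵐ x : ℝ, (𝓕 (evenExt f) : Lp ℂ 2 (volume : Measure ℝ)) (-x) =
      (𝓕 (evenExt f) : Lp ℂ 2 (volume : Measure ℝ)) x := by
  have hmp : MeasurePreserving (fun t : ℝ => -t) volume volume :=
    Measure.measurePreserving_neg volume
  have e1 : Lp.compMeasurePreserving (fun t : ℝ => -t) hmp (evenExt f) = evenExt f := by
    apply Lp.ext
    refine (Lp.coeFn_compMeasurePreserving _ hmp).trans ?_
    refine (hmp.quasiMeasurePreserving.ae_eq (memLp_even f).coeFn_toLp).trans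
      (EventuallyEq.trans ?_ (memLp_even f).coeFn_toLp.symm)
    exact Eventually.of_forall fun x => by simp
  have e2 := fourier_compMeasurePreserving_neg (evenExt f)
  rw [e1] at e2
  have e3 := Lp.coeFn_compMeasurePreserving (𝓕 (evenExt f)) hmp
  rw [← e2] at e3
  filter_upwards [e3] with x hx
  exact hx.symm

theorem integral_eq_two_mul_Ioi {h : ℝ → ℂ} (hi : Integrable h) (he : ∀ᵐ x, h (-x) = h x) :
    ∫ x, h x = 2 * ∫ x in Ioi (0 : ℝ), h x := by
  rw [← integral_add_compl (measurableSet_Ioi (a := (0 : ℝ))) hi, compl_Ioi, two_mul]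
  congr 1
  have h1 := integral_comp_neg_Ioi 0 h
  rw [neg_zero] at h1
  rw [← h1]
  exact setIntegral_congr_ae measurableSet_Ioi (he.mono fun x hx _ => hx)

/-- Parseval's identity for the cosine transform, against a real even test function whose Fourier
transform is also real. -/
theorem integral_mul_cosineTransform (f : K) {g k : ℝ → ℝ}
    (h1 : Integrable (fun x => (g x : ℂ))) (h2 : MemLp (fun x => (g x : ℂ)) 2 volume)
    (hk : 𝓕 (fun x => (g x : ℂ)) = fun x => (k x : ℂ)) (hk2 : MemLp (fun x => (k x : ℂ)) 2 volume)
    (hg_even : ∀ x, g (-x) = g x) (hk_even : ∀ x, k (-x) = k x) :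
    ∫ x in Ioi (0 : ℝ), (k x : ℂ) * cosineTransform f x =
      ∫ x in Ioi (0 : ℝ), (g x : ℂ) * f x := by
  have hP := integral_conj_fourier_mul h1 h2 (evenExt f)
  rw [hk] at hP
  simp only [Complex.conj_ofReal] at hP
  have i1 : Integrable (fun x => (k x : ℂ) * (𝓕 (evenExt f) : Lp ℂ 2 (volume : Measure ℝ)) x) :=
    memLp_one_iff_integrable.1 ((Lp.memLp (𝓕 (evenExt f))).mul hk2)
  have i2 : Integrable (fun x => (g x : ℂ) * (evenExt f) x) :=
    memLp_one_iff_integrable.1 ((Lp.memLp (evenExt f)).mul h2)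
  have hE : ∀ᵐ x : ℝ, (evenExt f) x = (f : ℝ → ℂ) |x| := (memLp_even f).coeFn_toLp
  have hE' : ∀ᵐ x : ℝ, (evenExt f) (-x) = (f : ℝ → ℂ) |-x| :=
    (Measure.measurePreserving_neg (volume : Measure ℝ)).quasiMeasurePreserving.ae hE
  rw [integral_eq_two_mul_Ioi i1, integral_eq_two_mul_Ioi i2] at hP
  · have hP' := mul_left_cancel₀ two_ne_zero hP
    have c1 : ∫ x in Ioi (0 : ℝ), (k x : ℂ) * cosineTransform f x = ∫ x in Ioi (0 : ℝ),
        (k x : ℂ) * (𝓕 (evenExt f) : Lp ℂ 2 (volume : Measure ℝ)) x := by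
      refine integral_congr_ae ?_
      have : cosineTransform f =ᵐ[volume.restrict (Ioi (0 : ℝ))]
          (𝓕 (evenExt f) : Lp ℂ 2 (volume : Measure ℝ)) := MemLp.coeFn_toLp _
      filter_upwards [this] with x hx
      rw [hx]
    have c2 : ∫ x in Ioi (0 : ℝ), (g x : ℂ) * f x =
        ∫ x in Ioi (0 : ℝ), (g x : ℂ) * (evenExt f) x := by
      refine integral_congr_ae ?_
      filter_upwards [ae_restrict_of_ae hE, ae_restrict_mem measurableSet_Ioi] with x hx hx0
      rw [hx, abs_of_pos hx0]
    rw [c1, c2, hP']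
  · filter_upwards [hE, hE'] with x hx hx'
    rw [hx, hx', abs_neg, hg_even]
  · filter_upwards [fourier_evenExt_neg f] with x hx
    rw [hx, hk_even]

/-! ### Riemann's self-dual kernel. -/

/-- Riemann's kernel `(2π²t⁴ - 3πt²) exp(-πt²)`, a self-dual even Schwartz function which vanishes
at the origin. -/
noncomputable def riemannKernel (t : ℝ) : ℝ :=
  (2 * Real.pi ^ 2 * t ^ 4 - 3 * Real.pi * t ^ 2) * Real.exp (-Real.pi * t ^ 2)

theorem continuous_riemannKernel : Continuous riemannKernel := by
  unfold riemannKernel; fun_prop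

theorem riemannKernel_neg (t : ℝ) : riemannKernel (-t) = riemannKernel t := by
  simp [riemannKernel, Even.neg_pow (by decide : Even 4)]

theorem integrable_pow_mul_exp_neg_mul_sq {b : ℝ} (hb : 0 < b) (n : ℕ) :
    Integrable fun x : ℝ => x ^ n * Real.exp (-b * x ^ 2) := by
  have := integrable_rpow_mul_exp_neg_mul_sq hb (s := n) (by
    have : (0 : ℝ) ≤ n := Nat.cast_nonneg n
    linarith)
  simpa using this

theorem integrable_riemannKernel : Integrable riemannKernel := by
  have h4 := (integrable_pow_mul_exp_neg_mul_sq Real.pi_pos 4).const_mul (2 * Real.pi ^ 2)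
  have h2 := (integrable_pow_mul_exp_neg_mul_sq Real.pi_pos 2).const_mul (3 * Real.pi)
  refine (h4.sub h2).congr (Eventually.of_forall fun t => ?_)
  simp only [riemannKernel, Pi.sub_apply]
  ring

theorem exists_pow_mul_exp_le (n : ℕ) :
    ∃ C : ℝ, ∀ t : ℝ, |t| ^ n * Real.exp (-Real.pi * t ^ 2) ≤ C := by
  refine ⟨1 + n.factorial / Real.pi ^ n, fun t => ?_⟩
  have h1 : (Real.pi * t ^ 2) ^ n / n.factorial ≤ Real.exp (Real.pi * t ^ 2) :=
    Real.pow_div_factorial_le_exp _ (by positivity) n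
  have hf : (0 : ℝ) < n.factorial := by positivity
  have hp : 0 < Real.pi ^ n := by positivity
  have he : 1 ≤ Real.exp (Real.pi * t ^ 2) := Real.one_le_exp (by positivity)
  -- This trades a possibly odd power of |t| for a power of t², which the exponential series in πt²
  -- controls.
  have h2 : |t| ^ n ≤ 1 + (t ^ 2) ^ n := by
    have : (t ^ 2) ^ n = (|t| ^ n) ^ 2 := by rw [← sq_abs, ← pow_mul, ← pow_mul, mul_comm]
    rw [this]
    nlinarith [sq_nonneg (|t| ^ n - 1), pow_nonneg (abs_nonneg t) n]
  have h3 : (t ^ 2) ^ n ≤ n.factorial / Real.pi ^ n * Real.exp (Real.pi * t ^ 2) := by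
    rw [mul_pow, div_le_iff₀ hf] at h1
    rw [div_mul_eq_mul_div, le_div_iff₀ hp]
    linarith
  rw [neg_mul, Real.exp_neg, ← div_eq_mul_inv, div_le_iff₀ (Real.exp_pos _)]
  linarith

theorem exists_pow_mul_riemannKernel_le (n : ℕ) :
    ∃ C : ℝ, 0 ≤ C ∧ ∀ t : ℝ, |t| ^ n * |riemannKernel t| ≤ C := by
  obtain ⟨A, hA⟩ := exists_pow_mul_exp_le (n + 4)
  obtain ⟨B, hB⟩ := exists_pow_mul_exp_le (n + 2)
  have key : ∀ t : ℝ, |t| ^ n * |riemannKernel t| ≤ 2 * Real.pi ^ 2 * A + 3 * Real.pi * B := by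
    intro t
    have h1 : |riemannKernel t| ≤
        (2 * Real.pi ^ 2 * |t| ^ 4 + 3 * Real.pi * |t| ^ 2) * Real.exp (-Real.pi * t ^ 2) := by
      rw [riemannKernel, abs_mul, abs_of_pos (Real.exp_pos _)]
      refine mul_le_mul_of_nonneg_right ?_ (Real.exp_pos _).le
      refine (abs_sub _ _).trans (le_of_eq ?_)
      simp [abs_mul, abs_of_pos Real.pi_pos]
    calc |t| ^ n * |riemannKernel t| ≤ |t| ^ n * ((2 * Real.pi ^ 2 * |t| ^ 4 +
          3 * Real.pi * |t| ^ 2) * Real.exp (-Real.pi * t ^ 2)) :=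
          mul_le_mul_of_nonneg_left h1 (by positivity)
      _ = 2 * Real.pi ^ 2 * (|t| ^ (n + 4) * Real.exp (-Real.pi * t ^ 2)) +
          3 * Real.pi * (|t| ^ (n + 2) * Real.exp (-Real.pi * t ^ 2)) := by ring
      _ ≤ _ := by gcongr <;> simp_all
  refine ⟨_, (key 0).trans' (by positivity), key⟩

theorem memLp_two_riemannKernel : MemLp (fun t => (riemannKernel t : ℂ)) 2 volume := by
  obtain ⟨C, hC0, hC⟩ := exists_pow_mul_riemannKernel_le 0
  have hm : AEStronglyMeasurable (fun t => (riemannKernel t : ℂ)) volume :=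
    (Complex.continuous_ofReal.comp continuous_riemannKernel).aestronglyMeasurable
  rw [memLp_two_iff_integrable_sq_norm hm]
  refine (integrable_riemannKernel.norm.const_mul C).mono' (by fun_prop) ?_
  refine Eventually.of_forall fun t => ?_
  have := hC t
  simp only [pow_zero, one_mul] at this
  rw [Complex.norm_real, Real.norm_eq_abs, Real.norm_eq_abs, abs_of_nonneg (sq_nonneg _), sq]
  exact mul_le_mul_of_nonneg_right this (abs_nonneg _)

section Fourier

/-- Multiplication by (-2πix)^n becomes the n-th derivative under the Fourier transform; the kernel
involves only n = 2 and n = 4. -/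
theorem iteratedDeriv_exp_neg_pi_sq :
    iteratedDeriv 2 (fun t : ℝ => Complex.exp (-Real.pi * (t : ℂ) ^ 2)) =
      (fun t : ℝ => (4 * Real.pi ^ 2 * (t : ℂ) ^ 2 - 2 * Real.pi) *
        Complex.exp (-Real.pi * (t : ℂ) ^ 2)) ∧
    iteratedDeriv 4 (fun t : ℝ => Complex.exp (-Real.pi * (t : ℂ) ^ 2)) =
      (fun t : ℝ => (16 * Real.pi ^ 4 * (t : ℂ) ^ 4 - 48 * Real.pi ^ 3 * (t : ℂ) ^ 2
        + 12 * Real.pi ^ 2) * Complex.exp (-Real.pi * (t : ℂ) ^ 2)) := by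
  have hp : ∀ (n : ℕ) (t : ℝ), HasDerivAt (fun t : ℝ => (t : ℂ) ^ n) (n * (t : ℂ) ^ (n - 1)) t :=
    fun n t => (hasDerivAt_pow n (t : ℂ)).comp_ofReal
  have hid : ∀ t : ℝ, HasDerivAt (fun t : ℝ => (t : ℂ)) 1 t := fun t =>
    (hasDerivAt_id (t : ℂ)).comp_ofReal
  have hg : ∀ t : ℝ, HasDerivAt (fun t : ℝ => Complex.exp (-Real.pi * (t : ℂ) ^ 2))
      (Complex.exp (-Real.pi * (t : ℂ) ^ 2) * (-Real.pi * (2 * t))) t := fun t => by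
    simpa using ((hp 2 t).const_mul (-(Real.pi : ℂ))).cexp
  have d1 : deriv (fun t : ℝ => Complex.exp (-Real.pi * (t : ℂ) ^ 2)) =
      fun t : ℝ => (-2 * Real.pi * (t : ℂ)) * Complex.exp (-Real.pi * (t : ℂ) ^ 2) :=
    funext fun t => (hg t).deriv.trans (by ring)
  have hmul : ∀ {p : ℝ → ℂ} {p' : ℂ} {t : ℝ}, HasDerivAt p p' t →
      deriv (fun t : ℝ => p t * Complex.exp (-Real.pi * (t : ℂ) ^ 2)) t =
        (p' - 2 * Real.pi * t * p t) * Complex.exp (-Real.pi * (t : ℂ) ^ 2) := fun {p p' t} h => by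
    have : HasDerivAt (fun t : ℝ => p t * Complex.exp (-Real.pi * (t : ℂ) ^ 2)) _ t := h.mul (hg t)
    rw [this.deriv]; ring
  have d2 : deriv (fun t : ℝ => (-2 * Real.pi * (t : ℂ)) * Complex.exp (-Real.pi * (t : ℂ) ^ 2)) =
      fun t : ℝ => (4 * Real.pi ^ 2 * (t : ℂ) ^ 2 - 2 * Real.pi) *
        Complex.exp (-Real.pi * (t : ℂ) ^ 2) := funext fun t => by
    rw [hmul ((hid t).const_mul (-2 * (Real.pi : ℂ)))]; ring
  have d3 : deriv (fun t : ℝ => (4 * Real.pi ^ 2 * (t : ℂ) ^ 2 - 2 * Real.pi) *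
        Complex.exp (-Real.pi * (t : ℂ) ^ 2)) =
      fun t : ℝ => (12 * Real.pi ^ 2 * (t : ℂ) - 8 * Real.pi ^ 3 * (t : ℂ) ^ 3) *
        Complex.exp (-Real.pi * (t : ℂ) ^ 2) := funext fun t => by
    rw [hmul (((hp 2 t).const_mul (4 * (Real.pi : ℂ) ^ 2)).sub_const (2 * (Real.pi : ℂ)))]
    push_cast; ring
  have d4 : deriv (fun t : ℝ => (12 * Real.pi ^ 2 * (t : ℂ) - 8 * Real.pi ^ 3 * (t : ℂ) ^ 3) *
        Complex.exp (-Real.pi * (t : ℂ) ^ 2)) =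
      fun t : ℝ => (16 * Real.pi ^ 4 * (t : ℂ) ^ 4 - 48 * Real.pi ^ 3 * (t : ℂ) ^ 2
        + 12 * Real.pi ^ 2) * Complex.exp (-Real.pi * (t : ℂ) ^ 2) := funext fun t => by
    have h : HasDerivAt (fun t : ℝ => 12 * (Real.pi : ℂ) ^ 2 * (t : ℂ) - 8 * Real.pi ^ 3 *
        (t : ℂ) ^ 3) _ t := ((hid t).const_mul (12 * (Real.pi : ℂ) ^ 2)).sub
      ((hp 3 t).const_mul (8 * (Real.pi : ℂ) ^ 3))
    rw [hmul h]
    push_cast; ring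
  constructor
  · rw [iteratedDeriv_succ, iteratedDeriv_one, d1, d2]
  · rw [iteratedDeriv_succ, iteratedDeriv_succ, iteratedDeriv_succ, iteratedDeriv_one,
      d1, d2, d3, d4]

/-- The Gaussian is self-dual, so the transform is a combination of its second and fourth
derivatives. With weights 3/(4π) and 1/(8π²) the constant terms -3/2 and 3/2 cancel and the
polynomial 2π²t⁴ - 3πt² reappears. -/
theorem fourier_riemannKernel :
    𝓕 (fun t => (riemannKernel t : ℂ)) = fun t => (riemannKernel t : ℂ) := by
  set g : ℝ → ℂ := fun t : ℝ => Complex.exp (-Real.pi * (t : ℂ) ^ 2) with hgdef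
  have hg : 𝓕 g = g := by
    have := fourier_gaussian_pi (b := 1) (by simp)
    simpa [hgdef] using this
  have hint : ∀ n : ℕ, Integrable (fun x : ℝ => x ^ n • g x) := fun n => by
    refine (integrable_pow_mul_exp_neg_mul_sq Real.pi_pos n).ofReal.congr
      (Eventually.of_forall fun t => ?_)
    simp [hgdef]
  have hf2 := Real.iteratedDeriv_fourier (f := g) (N := ⊤) (n := 2) (fun n _ => hint n) (by simp)
  have hf4 := Real.iteratedDeriv_fourier (f := g) (N := ⊤) (n := 4) (fun n _ => hint n) (by simp)
  rw [hg, iteratedDeriv_exp_neg_pi_sq.1] at hf2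
  rw [hg, iteratedDeriv_exp_neg_pi_sq.2] at hf4
  have hpi : (Real.pi : ℂ) ≠ 0 := by exact_mod_cast Real.pi_ne_zero
  have i2 : Integrable (fun x : ℝ => (-2 * Real.pi * Complex.I * x) ^ 2 • g x) := by
    refine ((hint 2).smul ((-2 * Real.pi * Complex.I) ^ 2)).congr (Eventually.of_forall fun t => ?_)
    simp; ring
  have i4 : Integrable (fun x : ℝ => (-2 * Real.pi * Complex.I * x) ^ 4 • g x) := by
    refine ((hint 4).smul ((-2 * Real.pi * Complex.I) ^ 4)).congr (Eventually.of_forall fun t => ?_)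
    simp; ring
  have hI4 : Complex.I ^ 4 = 1 := Complex.I_pow_four
  have e : (fun t => (riemannKernel t : ℂ)) =
      (1 / (8 * (Real.pi : ℂ) ^ 2)) • (fun x : ℝ => (-2 * Real.pi * Complex.I * x) ^ 4 • g x) +
      (3 / (4 * (Real.pi : ℂ))) • (fun x : ℝ => (-2 * Real.pi * Complex.I * x) ^ 2 • g x) := by
    funext t
    simp only [riemannKernel, hgdef, Pi.add_apply, Pi.smul_apply, smul_eq_mul, mul_pow, hI4,
      Complex.I_sq]
    push_cast
    field_simp
    ring
  have lin : ∀ (u v : ℝ → ℂ) (c d : ℂ), Integrable u → Integrable v →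
      𝓕 (c • u + d • v) = c • 𝓕 u + d • 𝓕 v := by
    intro u v c d hu hv
    have hadd := VectorFourier.fourierIntegral_add (e := Real.fourierChar) (μ := volume)
      (L := innerₗ ℝ) Real.continuous_fourierChar (by exact continuous_inner)
      (hu.smul c) (hv.smul d)
    have h1 := VectorFourier.fourierIntegral_const_smul Real.fourierChar volume (innerₗ ℝ) u c
    have h2 := VectorFourier.fourierIntegral_const_smul Real.fourierChar volume (innerₗ ℝ) v d
    rw [h1, h2] at hadd
    exact hadd
  rw [e, lin _ _ _ _ i4 i2, ← hf2, ← hf4]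
  funext t
  simp only [hgdef, Pi.add_apply, Pi.smul_apply, smul_eq_mul, mul_pow, hI4, Complex.I_sq]
  field_simp
  ring

theorem fourier_riemannKernel_scale {x : ℝ} (hx : 0 < x) :
    𝓕 (fun t => ((riemannKernel (t * x⁻¹) : ℝ) : ℂ)) =
      fun t => ((x * riemannKernel (t * x) : ℝ) : ℂ) := by
  funext ξ
  have h := congrFun fourier_riemannKernel (ξ * x)
  rw [Real.fourier_real_eq] at h ⊢
  push_cast
  rw [← h]
  have := Measure.integral_comp_mul_right
    (fun v => Real.fourierChar (-(v * (ξ * x))) • ((riemannKernel v : ℝ) : ℂ)) x⁻¹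
  rw [inv_inv, abs_of_pos hx, Complex.real_smul] at this
  rw [← this]
  congr 1
  funext v
  congr 3
  field_simp

end Fourier

/-! ### Mellin transform of the kernel. -/

section Mellin

theorem hasMellin_exp_neg_pi_sq {s : ℂ} (hs : 0 < s.re) :
    HasMellin (fun t : ℝ => Complex.exp (-Real.pi * (t : ℂ) ^ 2)) s
      (2⁻¹ * (Real.pi : ℂ) ^ (-s / 2) * Complex.Gamma (s / 2)) := by
  have hs2 : 0 < (s / 2).re := by simpa using hs
  refine ⟨?_, ?_⟩
  · have h1 : MellinConvergent (fun t : ℝ => Complex.exp (-Real.pi * t)) (s / 2) := by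
      refine mellinConvergent_of_isBigO_rpow_exp (a := Real.pi) (b := 0) Real.pi_pos ?_ ?_ ?_ hs2
      · exact (by fun_prop : Continuous fun t : ℝ =>
          Complex.exp (-Real.pi * t)).locallyIntegrable.locallyIntegrableOn _
      · refine isBigO_of_le _ fun t => ?_
        rw [Complex.norm_exp, Real.norm_eq_abs, Real.abs_exp]
        simp
      · simp only [neg_zero, Real.rpow_zero]
        refine ContinuousAt.continuousWithinAt ?_ |>.isBigO_one ℝ
        fun_prop
    have := (MellinConvergent.comp_rpow (f := fun t : ℝ => Complex.exp (-Real.pi * t)) (s := s)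
      (a := 2) two_ne_zero).2 (by simpa using h1)
    refine this.congr_fun (fun t _ => ?_) measurableSet_Ioi
    simp
  · have h1 := mellin_comp_rpow (fun t : ℝ => Complex.exp (-Real.pi * t)) s 2
    have h2 : mellin (fun t : ℝ => Complex.exp (-Real.pi * t)) (s / 2) =
        (1 / (Real.pi : ℂ)) ^ (s / 2) * Complex.Gamma (s / 2) := by
      rw [← Complex.integral_cpow_mul_exp_neg_mul_Ioi hs2 Real.pi_pos]
      simp [mellin]
    have h3 : mellin (fun t : ℝ => Complex.exp (-Real.pi * (t : ℂ) ^ 2)) s =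
        mellin (fun t : ℝ => Complex.exp (-Real.pi * ((t ^ (2 : ℝ) : ℝ) : ℂ))) s := by
      simp
    rw [h3, h1]
    simp only [Complex.ofReal_ofNat]
    rw [h2, abs_of_pos two_pos, Complex.real_smul, one_div,
      Complex.inv_cpow _ _ (by rw [Complex.arg_ofReal_of_nonneg Real.pi_pos.le]; exact Real.pi_ne_zero.symm),
      ← Complex.cpow_neg]
    push_cast
    rw [neg_div, mul_assoc]

/-- The archimedean factor `½ π^(-s/2) Γ(s/2 + 1)`. -/
noncomputable def gammaFactor (s : ℂ) : ℂ :=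
  2⁻¹ * (Real.pi : ℂ) ^ (-s / 2) * Complex.Gamma (s / 2 + 1)

/-- The factor t² shifts s by 2 in the Gaussian's Mellin transform, which widens the half-plane to
Re s > -2. -/
theorem hasMellin_pi_mul_sq_mul_exp {s : ℂ} (hs : -2 < s.re) :
    HasMellin (fun t : ℝ => Real.pi * (t : ℂ) ^ 2 * Complex.exp (-Real.pi * (t : ℂ) ^ 2)) s
      (gammaFactor s) := by
  have hpi : (Real.pi : ℂ) ≠ 0 := by exact_mod_cast Real.pi_ne_zero
  have h := hasMellin_exp_neg_pi_sq (s := s + 2) (by simp; linarith)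
  have e : (fun t : ℝ => Real.pi * (t : ℂ) ^ 2 * Complex.exp (-Real.pi * (t : ℂ) ^ 2)) =
      fun t : ℝ => (Real.pi : ℂ) • ((t : ℂ) ^ (2 : ℂ) • Complex.exp (-Real.pi * (t : ℂ) ^ 2)) := by
    funext t; simp [mul_assoc]
  refine ⟨?_, ?_⟩
  · rw [e]
    exact (MellinConvergent.cpow_smul.2 h.1).const_smul _
  · rw [e, mellin_const_smul, mellin_cpow_smul, h.2, gammaFactor, smul_eq_mul,
      show -(s + 2) / 2 = -s / 2 - 1 by ring, Complex.cpow_sub _ _ hpi, Complex.cpow_one,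
      show (s + 2) / 2 = s / 2 + 1 by ring]
    field_simp

/-- The factor s-1 is 2(s/2+1) - 3: the quartic term is the quadratic one at s+2, and Γ(s/2+2) =
(s/2+1)Γ(s/2+1). -/
theorem hasMellin_riemannKernel {s : ℂ} (hs : -2 < s.re) :
    HasMellin (fun t => (riemannKernel t : ℂ)) s ((s - 1) * gammaFactor s) := by
  have hpi : (Real.pi : ℂ) ≠ 0 := by exact_mod_cast Real.pi_ne_zero
  have h2 := hasMellin_pi_mul_sq_mul_exp hs
  have h4 := hasMellin_pi_mul_sq_mul_exp (s := s + 2) (by simp; linarith)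
  have e : (fun t => (riemannKernel t : ℂ)) = fun t : ℝ =>
      (2 * Real.pi : ℂ) • ((t : ℂ) ^ (2 : ℂ) •
        (Real.pi * (t : ℂ) ^ 2 * Complex.exp (-Real.pi * (t : ℂ) ^ 2))) -
      (3 : ℂ) • (Real.pi * (t : ℂ) ^ 2 * Complex.exp (-Real.pi * (t : ℂ) ^ 2)) := by
    funext t
    simp only [riemannKernel, smul_eq_mul, Complex.cpow_ofNat]
    push_cast
    ring
  have c4 := (MellinConvergent.cpow_smul (a := 2).2 h4.1).const_smul (2 * Real.pi : ℂ)
  have c2 := h2.1.const_smul (3 : ℂ)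
  have := hasMellin_sub c4 c2
  rw [e]
  refine ⟨this.1, ?_⟩
  rw [this.2, mellin_const_smul, mellin_const_smul, mellin_cpow_smul, h4.2, h2.2]
  have hne : s / 2 + 1 ≠ 0 := by
    intro h0
    have := congrArg Complex.re h0
    simp at this
    linarith
  simp only [gammaFactor, smul_eq_mul]
  rw [show -(s + 2) / 2 = -s / 2 - 1 by ring, Complex.cpow_sub _ _ hpi, Complex.cpow_one,
    show (s + 2) / 2 + 1 = (s / 2 + 1) + 1 by ring, Complex.Gamma_add_one _ hne]
  field_simp
  ring

end Mellin

/-- The kernel has the elementary primitive -t·π(tx)²exp(-π(tx)²), vanishing at t = 0. Hence a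
constant on (0, a) contributes only a Gaussian-small term for large x. -/
theorem integral_riemannKernel_mul {a : ℝ} (ha : 0 ≤ a) (x : ℝ) :
    ∫ t in Ioc 0 a, (riemannKernel (t * x) : ℂ) =
      -(a * (Real.pi * ((a * x : ℝ) : ℂ) ^ 2 *
        Complex.exp (-Real.pi * ((a * x : ℝ) : ℂ) ^ 2))) := by
  rw [← intervalIntegral.integral_of_le ha, intervalIntegral.integral_ofReal]
  have hd : ∀ t : ℝ, HasDerivAt (fun t : ℝ => -(t * (Real.pi * (t * x) ^ 2 *
      Real.exp (-Real.pi * (t * x) ^ 2)))) (riemannKernel (t * x)) t := fun t => by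
    have h1 : HasDerivAt (fun t : ℝ => (t * x) ^ 2) (2 * (t * x) * x) t := by
      convert! ((hasDerivAt_id t).mul_const x).pow 2 using 1
      simp
    convert! ((hasDerivAt_id t).mul ((h1.const_mul Real.pi).mul
      (h1.const_mul (-Real.pi)).exp)).neg using 1
    simp only [riemannKernel, Pi.mul_apply, id]
    ring
  rw [intervalIntegral.integral_eq_sub_of_hasDerivAt (fun t _ => hd t)
    ((continuous_riemannKernel.comp (continuous_mul_const x)).intervalIntegrable _ _)]
  push_cast
  ring

/-! ### Theta integrals: decay, inversion and Mellin transform. -/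

section

/-- The integral of `f` against the dilates of Riemann's kernel. -/
noncomputable def theta (f : ℝ → ℂ) (x : ℝ) : ℂ :=
  ∫ t in Ioi (0 : ℝ), (riemannKernel (t * x) : ℂ) * f t

/-- The incomplete right Mellin transform `∫ₐ^∞ f(t) t^(-s) dt`. -/
noncomputable def tailMellin (a : ℝ) (f : ℝ → ℂ) (s : ℂ) : ℂ :=
  ∫ t in Ioi a, f t * (t : ℂ) ^ (-s)

variable {f : ℝ → ℂ} {a : ℝ}

theorem memLp_Ioi (hf : MemLp f 2 (volume.restrict (Ioi 0))) (ha : 0 < a) :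
    MemLp f 2 (volume.restrict (Ioi a)) :=
  hf.mono_measure (Measure.restrict_mono (Ioi_subset_Ioi ha.le) le_rfl)

/-- Cauchy–Schwarz: t^(-σ) is square-integrable on (a, ∞) because 2σ > 1. -/
theorem integrableOn_norm_mul_rpow (hf : MemLp f 2 (volume.restrict (Ioi 0))) (ha : 0 < a)
    {σ : ℝ} (hσ : 1 / 2 < σ) : IntegrableOn (fun t => ‖f t‖ * t ^ (-σ)) (Ioi a) := by
  have hm : AEStronglyMeasurable (fun t : ℝ => t ^ (-σ)) (volume.restrict (Ioi a)) :=
    (measurable_id.pow_const _).aestronglyMeasurable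
  have h2 : MemLp (fun t : ℝ => t ^ (-σ)) 2 (volume.restrict (Ioi a)) := by
    rw [memLp_two_iff_integrable_sq hm]
    refine (integrableOn_Ioi_rpow_of_lt (a := -σ * 2) (by linarith) ha).congr_fun ?_
      measurableSet_Ioi
    intro t ht
    have ht0 : 0 < t := ha.trans ht
    simp only
    rw [Real.rpow_mul ht0.le, Real.rpow_two]
  exact memLp_one_iff_integrable.1 (h2.mul (memLp_Ioi hf ha).norm)

theorem aestronglyMeasurable_cpow_mul {μ : Measure ℝ} (hf : AEStronglyMeasurable f μ) (s : ℂ) :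
    AEStronglyMeasurable (fun t : ℝ => f t * (t : ℂ) ^ s) μ :=
  hf.mul (Complex.measurable_ofReal.pow_const s).aestronglyMeasurable

theorem norm_mul_cpow {t : ℝ} (ht : 0 < t) (z s : ℂ) :
    ‖z * (t : ℂ) ^ (-s)‖ = ‖z‖ * t ^ (-s.re) := by
  rw [norm_mul, Complex.norm_cpow_eq_rpow_re_of_pos ht, Complex.neg_re]

theorem integrableOn_mul_cpow (hf : MemLp f 2 (volume.restrict (Ioi 0))) (ha : 0 < a)
    {s : ℂ} (hs : 1 / 2 < s.re) : IntegrableOn (fun t => f t * (t : ℂ) ^ (-s)) (Ioi a) := by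
  refine (integrableOn_norm_mul_rpow hf ha hs).mono'
    (aestronglyMeasurable_cpow_mul (memLp_Ioi hf ha).1 _) ?_
  filter_upwards [ae_restrict_mem measurableSet_Ioi] with t ht
  exact (norm_mul_cpow (ha.trans ht) _ _).le

theorem exists_norm_tailMellin_le (hf : MemLp f 2 (volume.restrict (Ioi 0))) (ha : 0 < a)
    {σ : ℝ} (hσ : 1 / 2 < σ) (β : ℝ) :
    ∃ B : ℝ, 0 ≤ B ∧ ∀ s : ℂ, σ ≤ s.re → s.re ≤ β → ‖tailMellin a f s‖ ≤ B := by
  have h1 := integrableOn_norm_mul_rpow hf ha hσ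
  -- The maximum keeps the exponent above 1/2 for every β. In the strip t^(-Re s) is dominated by
  -- the sum of the two extreme powers, according to whether t ≥ 1 or t ≤ 1.
  have h2 := integrableOn_norm_mul_rpow hf ha (σ := max σ β) (lt_max_of_lt_left hσ)
  refine ⟨∫ t in Ioi a, (‖f t‖ * t ^ (-σ) + ‖f t‖ * t ^ (-max σ β)), ?_, fun s hs hs' => ?_⟩
  · refine setIntegral_nonneg measurableSet_Ioi fun t ht => ?_
    have ht0 : 0 < t := ha.trans ht
    positivity
  · refine norm_integral_le_of_norm_le (h1.add h2) ?_
    filter_upwards [ae_restrict_mem measurableSet_Ioi] with t ht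
    have ht0 : 0 < t := ha.trans ht
    rw [norm_mul_cpow ht0, ← mul_add]
    refine mul_le_mul_of_nonneg_left ?_ (norm_nonneg _)
    rcases le_total 1 t with h | h
    · exact (Real.rpow_le_rpow_of_exponent_le h (neg_le_neg hs)).trans
        (le_add_of_nonneg_right (by positivity))
    · exact (Real.rpow_le_rpow_of_exponent_ge ht0 h
        (neg_le_neg (hs'.trans (le_max_right _ _)))).trans (le_add_of_nonneg_left (by positivity))

theorem memLp_two_riemannKernel_scale {x : ℝ} (hx : x ≠ 0) :
    MemLp (fun t => (riemannKernel (t * x) : ℂ)) 2 volume := by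
  have hm : AEStronglyMeasurable (fun t => (riemannKernel t : ℂ)) volume :=
    (Complex.continuous_ofReal.comp continuous_riemannKernel).aestronglyMeasurable
  have hm' : AEStronglyMeasurable (fun t => (riemannKernel (t * x) : ℂ)) volume :=
    (Complex.continuous_ofReal.comp
      (continuous_riemannKernel.comp (continuous_mul_const x))).aestronglyMeasurable
  rw [memLp_two_iff_integrable_sq_norm hm']
  exact ((memLp_two_iff_integrable_sq_norm hm).1 memLp_two_riemannKernel).comp_mul_right' hx

theorem integrable_riemannKernel_mul (hf : MemLp f 2 (volume.restrict (Ioi 0))) {x : ℝ}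
    (hx : x ≠ 0) :
    IntegrableOn (fun t => (riemannKernel (t * x) : ℂ) * f t) (Ioi 0) :=
  memLp_one_iff_integrable.1 (hf.mul ((memLp_two_riemannKernel_scale hx).restrict _))

/-- The contribution of a constant `c` on `(0, a)` to `theta`. -/
noncomputable def thetaHead (a : ℝ) (c : ℂ) (x : ℝ) : ℂ :=
  (-(c * a)) • (Real.pi * ((a * x : ℝ) : ℂ) ^ 2 * Complex.exp (-Real.pi * ((a * x : ℝ) : ℂ) ^ 2))

/-- The contribution of `(a, ∞)` to `theta`. -/
noncomputable def thetaTail (a : ℝ) (f : ℝ → ℂ) (x : ℝ) : ℂ :=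
  ∫ t in Ioi a, (riemannKernel (t * x) : ℂ) * f t

theorem theta_eq (hf : MemLp f 2 (volume.restrict (Ioi 0))) (ha : 0 < a) {c : ℂ}
    (hc : ∀ᵐ t ∂(volume.restrict (Ioo (0 : ℝ) a)), f t = c) {x : ℝ} (hx : x ≠ 0) :
    theta f x = thetaHead a c x + thetaTail a f x := by
  have hi := integrable_riemannKernel_mul hf hx
  rw [theta, thetaTail, ← Ioc_union_Ioi_eq_Ioi ha.le, setIntegral_union
    (Ioc_disjoint_Ioi le_rfl) measurableSet_Ioi (hi.mono_set Ioc_subset_Ioi_self)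
    (hi.mono_set (Ioi_subset_Ioi ha.le))]
  congr 1
  have h1 : ∫ t in Ioc 0 a, (riemannKernel (t * x) : ℂ) * f t =
      ∫ t in Ioc 0 a, (riemannKernel (t * x) : ℂ) * c := by
    refine integral_congr_ae ?_
    rw [restrict_Ioo_eq_restrict_Ioc] at hc
    filter_upwards [hc] with t ht
    rw [ht]
  rw [h1, integral_mul_const, integral_riemannKernel_mul ha.le, thetaHead, smul_eq_mul]
  ring

/-- Here |φ(tx)| ≤ C(tx)^(-(n+1)); the exponent n+1 rather than n exceeds 1/2 even for n = 0, so
‖f‖·t^(-(n+1)) is integrable on (a, ∞). -/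
theorem norm_thetaTail_le (hf : MemLp f 2 (volume.restrict (Ioi 0))) (ha : 0 < a) (n : ℕ) :
    ∃ C : ℝ, ∀ x : ℝ, 0 < x → ‖thetaTail a f x‖ ≤ C * x ^ (-((n + 1 : ℕ) : ℝ)) := by
  obtain ⟨C, hC0, hC⟩ := exists_pow_mul_riemannKernel_le (n + 1)
  have hn : (1 : ℝ) / 2 < ((n + 1 : ℕ) : ℝ) := by
    push_cast
    have : (0 : ℝ) ≤ n := Nat.cast_nonneg n
    linarith
  have hi := integrableOn_norm_mul_rpow hf ha hn
  refine ⟨C * ∫ t in Ioi a, ‖f t‖ * t ^ (-((n + 1 : ℕ) : ℝ)), fun x hx => ?_⟩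
  have : C * (∫ t in Ioi a, ‖f t‖ * t ^ (-((n + 1 : ℕ) : ℝ))) * x ^ (-((n + 1 : ℕ) : ℝ)) =
      ∫ t in Ioi a, (C * x ^ (-((n + 1 : ℕ) : ℝ))) * (‖f t‖ * t ^ (-((n + 1 : ℕ) : ℝ))) := by
    rw [integral_const_mul]; ring
  rw [this]
  refine norm_integral_le_of_norm_le (hi.const_mul _) ?_
  filter_upwards [ae_restrict_mem measurableSet_Ioi] with t ht
  have ht0 : 0 < t := ha.trans ht
  have h := hC (t * x)
  rw [abs_of_pos (mul_pos ht0 hx)] at h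
  rw [norm_mul, Complex.norm_real, Real.norm_eq_abs, Real.rpow_neg hx.le, Real.rpow_neg ht0.le,
    Real.rpow_natCast, Real.rpow_natCast]
  have h' : |riemannKernel (t * x)| ≤ C * (x ^ (n + 1))⁻¹ * (t ^ (n + 1))⁻¹ := by
    rw [← div_eq_mul_inv, ← div_eq_mul_inv, div_div, le_div_iff₀ (by positivity), ← mul_pow,
      mul_comm x t, mul_comm]
    exact h
  calc _ ≤ C * (x ^ (n + 1))⁻¹ * (t ^ (n + 1))⁻¹ * ‖f t‖ :=
        mul_le_mul_of_nonneg_right h' (norm_nonneg _)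
    _ = _ := by ring

theorem thetaHead_isBigO (ha : 0 < a) (c : ℂ) (r : ℝ) :
    thetaHead a c =O[atTop] fun x => x ^ r := by
  obtain ⟨n, hn⟩ := exists_nat_ge (-r)
  obtain ⟨C, hC⟩ := exists_pow_mul_exp_le (n + 2)
  refine IsBigO.of_bound (‖c‖ * a * Real.pi * C * (a ^ n)⁻¹) ?_
  filter_upwards [eventually_ge_atTop 1] with x hx
  have hx0 : 0 < x := by linarith
  have hax : 0 < a * x := mul_pos ha hx0
  have h := hC (a * x)
  rw [abs_of_pos hax] at h
  have e : ‖thetaHead a c x‖ =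
      ‖c‖ * a * Real.pi * ((a * x) ^ 2 * Real.exp (-Real.pi * (a * x) ^ 2)) := by
    have : (-(Real.pi : ℂ) * ((a * x : ℝ) : ℂ) ^ 2) = ((-Real.pi * (a * x) ^ 2 : ℝ) : ℂ) := by
      push_cast; ring
    rw [thetaHead, this, norm_smul, norm_neg, norm_mul, norm_mul, norm_mul, norm_pow,
      Complex.norm_exp, Complex.ofReal_re]
    simp only [Complex.norm_real, Real.norm_eq_abs, abs_of_pos ha, abs_of_pos Real.pi_pos,
      abs_of_pos hax]
    ring
  have h2 : (a * x) ^ 2 * Real.exp (-Real.pi * (a * x) ^ 2) ≤ C * ((a * x) ^ n)⁻¹ := by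
    rw [← div_eq_mul_inv, le_div_iff₀ (by positivity)]
    calc _ = (a * x) ^ (n + 2) * Real.exp (-Real.pi * (a * x) ^ 2) := by ring
      _ ≤ C := h
  have hC0 : 0 ≤ C := h.trans' (by positivity)
  have h3 : (x ^ n)⁻¹ ≤ x ^ r := by
    rw [← Real.rpow_natCast, ← Real.rpow_neg hx0.le]
    exact Real.rpow_le_rpow_of_exponent_le hx (by linarith)
  rw [e, Real.norm_eq_abs, abs_of_pos (Real.rpow_pos_of_pos hx0 r)]
  calc _ ≤ ‖c‖ * a * Real.pi * (C * ((a * x) ^ n)⁻¹) := by gcongr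
    _ = ‖c‖ * a * Real.pi * C * (a ^ n)⁻¹ * (x ^ n)⁻¹ := by rw [mul_pow, mul_inv]; ring
    _ ≤ _ := by gcongr

theorem theta_isBigO (hf : MemLp f 2 (volume.restrict (Ioi 0))) (ha : 0 < a) {c : ℂ}
    (hc : ∀ᵐ t ∂(volume.restrict (Ioo (0 : ℝ) a)), f t = c) (r : ℝ) :
    theta f =O[atTop] fun x => x ^ r := by
  have h1 : theta f =ᶠ[atTop] fun x => thetaHead a c x + thetaTail a f x := by
    filter_upwards [eventually_gt_atTop 0] with x hx
    exact theta_eq hf ha hc hx.ne'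
  refine h1.trans_isBigO ((thetaHead_isBigO ha c r).add ?_)
  obtain ⟨n, hn⟩ := exists_nat_ge (-r)
  obtain ⟨C, hC⟩ := norm_thetaTail_le hf ha n
  refine IsBigO.trans (IsBigO.of_bound C (g := fun x : ℝ => x ^ (-((n + 1 : ℕ) : ℝ))) ?_)
    (IsBigO.of_bound 1 ?_)
  · filter_upwards [eventually_gt_atTop 0] with x hx
    rw [Real.norm_eq_abs, abs_of_pos (Real.rpow_pos_of_pos hx _)]
    exact hC x hx
  · filter_upwards [eventually_ge_atTop 1] with x hx
    have hx0 : 0 < x := by linarith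
    rw [one_mul, Real.norm_eq_abs, Real.norm_eq_abs, abs_of_pos (Real.rpow_pos_of_pos hx0 _),
      abs_of_pos (Real.rpow_pos_of_pos hx0 _)]
    refine Real.rpow_le_rpow_of_exponent_le hx ?_
    push_cast
    linarith

theorem continuousOn_theta (hf : MemLp f 2 (volume.restrict (Ioi 0))) :
    ContinuousOn (theta f) (Ioi 0) := by
  intro x₀ hx₀
  have hx₀' : 0 < x₀ := hx₀
  refine ContinuousAt.continuousWithinAt ?_
  obtain ⟨A, hA0, hA⟩ := exists_pow_mul_riemannKernel_le 0
  obtain ⟨B, hB0, hB⟩ := exists_pow_mul_riemannKernel_le 2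
  -- For x > x₀/2 this yields the x-independent majorant (A+B)/(1+(tx₀/2)²), which is
  -- square-integrable in t and can be paired with `f`.
  have hbd : ∀ y : ℝ, |riemannKernel y| ≤ (A + B) * (1 + y ^ 2)⁻¹ := fun y => by
    have h1 := hA y
    have h2 := hB y
    rw [sq_abs] at h2
    rw [← div_eq_mul_inv, le_div_iff₀ (by positivity)]
    linarith
  have hint : MemLp (fun t : ℝ => (1 + (t * (x₀ / 2)) ^ 2)⁻¹) 2 volume := by
    have hm : AEStronglyMeasurable (fun t : ℝ => (1 + (t * (x₀ / 2)) ^ 2)⁻¹) volume := by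
      refine Continuous.aestronglyMeasurable (Continuous.inv₀ (by fun_prop) fun t => ?_)
      positivity
    rw [memLp_two_iff_integrable_sq hm]
    have := integrable_inv_one_add_sq.comp_mul_right' (R := x₀ / 2) (by positivity)
    refine this.mono' (hm.pow 2) (Eventually.of_forall fun t => ?_)
    have h1 : 1 ≤ 1 + (t * (x₀ / 2)) ^ 2 := by nlinarith [sq_nonneg (t * (x₀ / 2))]
    rw [Real.norm_eq_abs, abs_of_nonneg (sq_nonneg _), sq]
    exact mul_le_of_le_one_right (by positivity) (inv_le_one_of_one_le₀ h1)
  refine continuousAt_of_dominated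
    (bound := fun t => (A + B) * (1 + (t * (x₀ / 2)) ^ 2)⁻¹ * ‖f t‖) ?_ ?_ ?_ ?_
  · refine Eventually.of_forall fun x => AEStronglyMeasurable.mul ?_ hf.1
    exact (Complex.continuous_ofReal.comp
      (continuous_riemannKernel.comp (continuous_mul_const x))).aestronglyMeasurable
  · filter_upwards [lt_mem_nhds (half_lt_self hx₀')] with x hx
    refine Eventually.of_forall fun t => ?_
    rw [norm_mul, Complex.norm_real, Real.norm_eq_abs]
    refine mul_le_mul_of_nonneg_right ((hbd _).trans ?_) (norm_nonneg _)
    have : (t * (x₀ / 2)) ^ 2 ≤ (t * x) ^ 2 := by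
      rw [mul_pow, mul_pow]
      gcongr
    gcongr
  · have : Integrable (fun t => (1 + (t * (x₀ / 2)) ^ 2)⁻¹ * ‖f t‖) (volume.restrict (Ioi 0)) :=
      memLp_one_iff_integrable.1 (hf.norm.mul (hint.restrict _))
    refine (this.const_mul (A + B)).congr (Eventually.of_forall fun t => ?_)
    simp only; ring
  · refine Eventually.of_forall fun t => ContinuousAt.mul ?_ continuousAt_const
    exact (Complex.continuous_ofReal.comp
      (continuous_riemannKernel.comp (continuous_const_mul t))).continuousAt

/-- Parseval with test function φ(t/x), whose Fourier transform is xφ(tx) by self-duality. This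
inversion formula becomes the functional equation. -/
theorem theta_one_div (f : K) {x : ℝ} (hx : 0 < x) :
    theta f (1 / x) = x * theta (cosineTransform f) x := by
  have h := integral_mul_cosineTransform f (g := fun t => riemannKernel (t * x⁻¹))
    (k := fun t => x * riemannKernel (t * x))
    ((integrable_riemannKernel.comp_mul_right' (inv_ne_zero hx.ne')).ofReal)
    (memLp_two_riemannKernel_scale (inv_ne_zero hx.ne')) (fourier_riemannKernel_scale hx)
    (by
      have := (memLp_two_riemannKernel_scale hx.ne').const_mul (x : ℂ)
      simpa using this)
    (fun t => by rw [neg_mul, riemannKernel_neg]) (fun t => by rw [neg_mul, riemannKernel_neg])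
  rw [theta, theta, one_div, ← h, ← integral_const_mul]
  congr 1
  funext t
  push_cast
  ring

/-- Fubini: the inner integral over x is the Mellin transform of a dilate of the kernel, giving
t^(-s). Absolute convergence rests on ∫ₐ^∞ ‖f‖t^(-Re s)dt, hence Re s > 1/2. -/
theorem hasMellin_thetaTail (hf : MemLp f 2 (volume.restrict (Ioi 0))) (ha : 0 < a) {s : ℂ}
    (hs : 1 / 2 < s.re) :
    HasMellin (thetaTail a f) s ((s - 1) * gammaFactor s * tailMellin a f s) := by
  have hφ := hasMellin_riemannKernel (s := s) (by linarith)
  have hfm := (memLp_Ioi hf ha).1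
  have hmeas : AEStronglyMeasurable
      (Function.uncurry fun (x t : ℝ) => (x : ℂ) ^ (s - 1) * ((riemannKernel (t * x) : ℂ) * f t))
      ((volume.restrict (Ioi 0)).prod (volume.restrict (Ioi a))) := by
    have h1 : Measurable fun p : ℝ × ℝ => (p.1 : ℂ) ^ (s - 1) :=
      (Complex.measurable_ofReal.comp measurable_fst).pow_const _
    have h2 : Continuous fun p : ℝ × ℝ => (riemannKernel (p.2 * p.1) : ℂ) :=
      Complex.continuous_ofReal.comp (continuous_riemannKernel.comp (by fun_prop))
    exact h1.aestronglyMeasurable.mul (h2.aestronglyMeasurable.mul hfm.comp_snd)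
  -- The dilation rule is applied to |φ| at the real point Re s, to evaluate the inner integral of
  -- norms.
  have hscale : ∀ t : ℝ, 0 < t →
      ∫ x in Ioi (0 : ℝ), ‖(x : ℂ) ^ (s - 1) * ((riemannKernel (t * x) : ℂ) * f t)‖ =
        ‖f t‖ * t ^ (-s.re) * ∫ x in Ioi (0 : ℝ), ‖(x : ℂ) ^ (s - 1) • (riemannKernel x : ℂ)‖ := by
    intro t ht
    have h1 := mellin_comp_mul_left (fun x => ((|riemannKernel x| : ℝ) : ℂ)) (s.re : ℂ) ht
    have conv1 : ∀ g : ℝ → ℝ, mellin (fun x => ((|g x| : ℝ) : ℂ)) (s.re : ℂ) =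
        ((∫ x in Ioi (0 : ℝ), ‖(x : ℂ) ^ (s - 1) * (g x : ℂ)‖ : ℝ) : ℂ) := by
      intro g
      rw [mellin, ← integral_complex_ofReal]
      refine setIntegral_congr_fun measurableSet_Ioi fun x hx => ?_
      have hx0 : 0 < x := hx
      simp only [norm_mul, Complex.norm_cpow_eq_rpow_re_of_pos hx0, Complex.norm_real,
        Real.norm_eq_abs, smul_eq_mul, Complex.sub_re, Complex.one_re]
      push_cast
      rw [Complex.ofReal_cpow hx0.le]
      push_cast
      rfl
    rw [conv1 (fun x => riemannKernel (t * x)), conv1 riemannKernel, ← Complex.ofReal_neg,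
      ← Complex.ofReal_cpow ht.le, smul_eq_mul, ← Complex.ofReal_mul] at h1
    have h2 := Complex.ofReal_injective h1
    simp only [smul_eq_mul]
    rw [mul_assoc, ← h2, ← integral_const_mul]
    refine integral_congr_ae (Eventually.of_forall fun x => ?_)
    simp only [norm_mul]
    ring
  have hprod : Integrable
      (Function.uncurry fun (x t : ℝ) => (x : ℂ) ^ (s - 1) * ((riemannKernel (t * x) : ℂ) * f t))
      ((volume.restrict (Ioi 0)).prod (volume.restrict (Ioi a))) := by
    rw [integrable_prod_iff' hmeas]
    refine ⟨?_, ?_⟩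
    · filter_upwards [ae_restrict_mem measurableSet_Ioi] with t ht
      have ht0 : 0 < t := ha.trans ht
      have h1 := (MellinConvergent.comp_mul_left ht0).2 hφ.1
      refine (Integrable.mul_const h1 (f t)).congr (Eventually.of_forall fun x => ?_)
      simp [mul_assoc]
    · refine ((integrableOn_norm_mul_rpow hf ha hs).mul_const
        (∫ x in Ioi (0 : ℝ), ‖(x : ℂ) ^ (s - 1) • (riemannKernel x : ℂ)‖)).congr ?_
      filter_upwards [ae_restrict_mem measurableSet_Ioi] with t ht
      exact (hscale t (ha.trans ht)).symm
  refine ⟨?_, ?_⟩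
  · refine hprod.integral_prod_left.congr (Eventually.of_forall fun x => ?_)
    simp only [Function.uncurry, thetaTail, smul_eq_mul, integral_const_mul]
  · calc mellin (thetaTail a f) s
        = ∫ x in Ioi (0 : ℝ), ∫ t in Ioi a,
            (x : ℂ) ^ (s - 1) * ((riemannKernel (t * x) : ℂ) * f t) := by
          rw [mellin]
          simp only [thetaTail, smul_eq_mul, integral_const_mul]
      _ = ∫ t in Ioi a, ∫ x in Ioi (0 : ℝ),
            (x : ℂ) ^ (s - 1) * ((riemannKernel (t * x) : ℂ) * f t) :=
          integral_integral_swap hprod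
      _ = ∫ t in Ioi a, (s - 1) * gammaFactor s * (f t * (t : ℂ) ^ (-s)) := by
          refine setIntegral_congr_fun measurableSet_Ioi fun t ht => ?_
          have ht0 : 0 < t := ha.trans ht
          have h1 := mellin_comp_mul_left (fun x => (riemannKernel x : ℂ)) s ht0
          rw [hφ.2, mellin] at h1
          simp only [smul_eq_mul] at h1
          simp only [← mul_assoc]
          rw [integral_mul_const, h1]
          ring
      _ = _ := by rw [integral_const_mul, tailMellin]

theorem hasMellin_thetaHead (ha : 0 < a) (c : ℂ) {s : ℂ} (hs : -2 < s.re) :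
    HasMellin (thetaHead a c) s (-(c * (a : ℂ) ^ (1 - s) * gammaFactor s)) := by
  have h := hasMellin_pi_mul_sq_mul_exp hs
  have h1 := (MellinConvergent.comp_mul_left ha).2 h.1
  refine ⟨h1.const_smul _, ?_⟩
  have h2 := mellin_comp_mul_left
    (fun t : ℝ => Real.pi * (t : ℂ) ^ 2 * Complex.exp (-Real.pi * (t : ℂ) ^ 2)) s ha
  have ha' : (a : ℂ) ≠ 0 := by exact_mod_cast ha.ne'
  have h3 : mellin (thetaHead a c) s = (-(c * a)) • mellin (fun x : ℝ => Real.pi *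
      ((a * x : ℝ) : ℂ) ^ 2 * Complex.exp (-Real.pi * ((a * x : ℝ) : ℂ) ^ 2)) s :=
    mellin_const_smul _ _ _
  rw [h3, h2, h.2, smul_eq_mul, smul_eq_mul, sub_eq_add_neg, Complex.cpow_add _ _ ha',
    Complex.cpow_one]
  ring

/-- On the half-plane `1/2 < Re s`, the Mellin transform of `theta f` is the product of the
archimedean factor and the right Mellin transform of `f`. -/
theorem mellin_theta (hf : MemLp f 2 (volume.restrict (Ioi 0))) (ha : 0 < a) {c : ℂ}
    (hc : ∀ᵐ t ∂(volume.restrict (Ioo (0 : ℝ) a)), f t = c) {s : ℂ} (hs : 1 / 2 < s.re) :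
    mellin (theta f) s =
      gammaFactor s * ((s - 1) * tailMellin a f s - c * (a : ℂ) ^ (1 - s)) := by
  have h1 := hasMellin_thetaHead ha c (s := s) (by linarith)
  have h2 := hasMellin_thetaTail hf ha hs
  have h3 := (hasMellin_add h1.1 h2.1).2
  have e : mellin (theta f) s = mellin (fun x => thetaHead a c x + thetaTail a f x) s := by
    refine setIntegral_congr_fun measurableSet_Ioi fun x hx => ?_
    simp only
    rw [theta_eq hf ha hc (ne_of_gt hx)]
  rw [e, h3, h1.2, h2.2]
  ring

end

/-! ### Phragmén–Lindelöf convexity in a vertical strip. -/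

theorem one_add_pow_mul_exp_le (n : ℕ) {u : ℝ} (hu : 0 ≤ u) :
    (1 + u) ^ n * Real.exp (-u ^ 2) ≤ n.factorial * Real.exp 2 := by
  have h1 := Real.pow_div_factorial_le_exp (1 + u) (by positivity) n
  rw [div_le_iff₀ (by positivity)] at h1
  calc (1 + u) ^ n * Real.exp (-u ^ 2)
      ≤ (Real.exp (1 + u) * n.factorial) * Real.exp (-u ^ 2) :=
        mul_le_mul_of_nonneg_right h1 (Real.exp_pos _).le
    _ = n.factorial * Real.exp (1 + u + -u ^ 2) := by rw [Real.exp_add (1 + u)]; ring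
    _ ≤ _ := by
        refine mul_le_mul_of_nonneg_left (Real.exp_le_exp.2 ?_) (by positivity)
        nlinarith [sq_nonneg (u - 1 / 2)]

theorem norm_exp_sub_sq_le {l r : ℝ} {s z : ℂ} (hs : l ≤ s.re) (hs' : s.re ≤ r) (hz : l ≤ z.re)
    (hz' : z.re ≤ r) :
    ‖Complex.exp ((s - z) ^ 2)‖ ≤ Real.exp ((r - l) ^ 2) * Real.exp (-|s.im - z.im| ^ 2) := by
  rw [Complex.norm_exp, ← Real.exp_add]
  refine Real.exp_le_exp.2 ?_
  have : ((s - z) ^ 2).re = (s.re - z.re) ^ 2 - (s.im - z.im) ^ 2 := by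
    rw [sq, Complex.mul_re, Complex.sub_re, Complex.sub_im]; ring
  rw [this, sq_abs]
  have h1 : |s.re - z.re| ≤ r - l := abs_le.2 ⟨by linarith, by linarith⟩
  have h2 : (s.re - z.re) ^ 2 ≤ (r - l) ^ 2 := by
    rw [← sq_abs]
    exact pow_le_pow_left₀ (abs_nonneg _) h1 2
  linarith

/-- The Phragmén–Lindelöf convexity bound in a vertical strip for a function that is bounded on the
right edge and polynomially bounded on the left edge. -/
theorem exists_convexity_bound {F : ℂ → ℂ} {l r : ℝ} (hlr : l < r) (n : ℕ)
    (hF : DiffContOnCl ℂ F (Complex.re ⁻¹' Ioo l r)) {A B : ℝ}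
    (hr : ∀ s : ℂ, s.re = r → ‖F s‖ ≤ A)
    (hl : ∀ s : ℂ, s.re = l → ‖F s‖ ≤ A * (1 + |s.im|) ^ n)
    (hg : ∀ s : ℂ, l ≤ s.re → s.re ≤ r → 1 ≤ |s.im| → ‖F s‖ ≤ B * Real.exp (2 * |s.im|)) :
    ∃ C : ℝ, 0 ≤ C ∧ ∀ s : ℂ, l ≤ s.re → s.re ≤ r →
      ‖F s‖ ≤ C * (1 + |s.im|) ^ (n / (r - l) * (r - s.re)) := by
  have hA : 0 ≤ A := (norm_nonneg _).trans (hr (r : ℂ) (Complex.ofReal_re r))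
  have hrl : 0 < r - l := sub_pos.2 hlr
  set E := Real.exp ((r - l) ^ 2) with hE
  have hE0 : 0 < E := Real.exp_pos _
  set κ : ℝ := n / (r - l) with hκ
  have hκ0 : 0 ≤ κ := by positivity
  refine ⟨A * E * (n.factorial * Real.exp 2), by positivity, fun z hz hz' => ?_⟩
  set R : ℝ := 1 + |z.im| with hR
  have hR1 : 1 ≤ R := by simp [hR]
  have hR0 : 0 < R := by linarith
  have hfac : 1 ≤ n.factorial * Real.exp 2 := by
    have h1 : (1 : ℝ) ≤ n.factorial := by exact_mod_cast Nat.one_le_iff_ne_zero.2 n.factorial_ne_zero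
    have h2 : 1 ≤ Real.exp 2 := Real.one_le_exp (by norm_num)
    nlinarith
  -- The comparison factor depends on the target point z: the first exponential has modulus R^(κ(Re
  -- s - r)), equal to R^(-n) on the left edge and 1 on the right, and the Gaussian localises near
  -- the height of z. All bounds on `H` are uniform in z.
  set H : ℂ → ℂ := fun s => F s * (Complex.exp (((κ * Real.log R : ℝ) : ℂ) * (s - r)) *
    Complex.exp ((s - z) ^ 2)) with hH
  have hpow : ∀ s : ℂ, ‖Complex.exp (((κ * Real.log R : ℝ) : ℂ) * (s - r))‖ =
      R ^ (κ * (s.re - r)) := fun s => by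
    rw [Complex.norm_exp, Complex.re_ofReal_mul, Complex.sub_re, Complex.ofReal_re,
      Real.rpow_def_of_pos hR0]
    ring_nf
  have hle1 : ∀ s : ℂ, s.re ≤ r → R ^ (κ * (s.re - r)) ≤ 1 := fun s hs =>
    Real.rpow_le_one_of_one_le_of_nonpos hR1
      (mul_nonpos_of_nonneg_of_nonpos hκ0 (by linarith))
  have hexp1 : ∀ s : ℂ, l ≤ s.re → s.re ≤ r → ‖Complex.exp ((s - z) ^ 2)‖ ≤ E :=
    fun s h1 h2 => (norm_exp_sub_sq_le h1 h2 hz hz').trans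
      (mul_le_of_le_one_right hE0.le (Real.exp_le_one_iff.2 (neg_nonpos.2 (sq_nonneg _))))
  have key : ‖H z‖ ≤ A * E * (n.factorial * Real.exp 2) := by
    refine PhragmenLindelof.vertical_strip (a := l) (b := r) ?_ ?_ ?_ ?_ hz hz'
    · have hd : Differentiable ℂ fun s : ℂ => Complex.exp (((κ * Real.log R : ℝ) : ℂ) * (s - r)) *
        Complex.exp ((s - z) ^ 2) := by fun_prop
      exact hF.smul hd.diffContOnCl
    -- Any exponent below π/(r-l) is admissible, and half of it suffices: exp(2|τ|) is at most
    -- exp((2/c)exp(c|τ|)).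
    · refine ⟨Real.pi / (r - l) / 2, half_lt_self (div_pos Real.pi_pos hrl),
        2 / (Real.pi / (r - l) / 2), ?_⟩
      set c := Real.pi / (r - l) / 2 with hc
      have hc0 : 0 < c := by positivity
      refine IsBigO.of_bound (B * E) ?_
      rw [eventually_inf_principal]
      have h1 : ∀ᶠ s in comap (_root_.abs ∘ Complex.im) atTop, 1 ≤ |s.im| :=
        tendsto_comap.eventually (eventually_ge_atTop 1)
      filter_upwards [h1] with s hs hs'
      have hl' : l ≤ s.re := hs'.1.le
      have hr' : s.re ≤ r := hs'.2.le
      have hg' := hg s hl' hr' hs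
      have hB : 0 ≤ B := by
        by_contra hB
        have h0 : B * Real.exp (2 * |s.im|) < 0 :=
          mul_neg_of_neg_of_pos (not_le.1 hB) (Real.exp_pos _)
        linarith [norm_nonneg (F s)]
      have h3 : Real.exp (2 * |s.im|) ≤ Real.exp (2 / c * Real.exp (c * |s.im|)) := by
        refine Real.exp_le_exp.2 ?_
        have := Real.add_one_le_exp (c * |s.im|)
        calc 2 * |s.im| = 2 / c * (c * |s.im|) := by field_simp
          _ ≤ _ := mul_le_mul_of_nonneg_left (by linarith) (by positivity)
      rw [Real.norm_eq_abs, abs_of_pos (Real.exp_pos _), hH]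
      simp only [norm_mul]
      rw [hpow]
      calc ‖F s‖ * (R ^ (κ * (s.re - r)) * ‖Complex.exp ((s - z) ^ 2)‖)
          ≤ (B * Real.exp (2 * |s.im|)) * (1 * E) :=
            mul_le_mul hg' (mul_le_mul (hle1 s hr') (hexp1 s hl' hr') (norm_nonneg _) zero_le_one)
              (by positivity) (by positivity)
        _ = B * E * Real.exp (2 * |s.im|) := by ring
        _ ≤ _ := mul_le_mul_of_nonneg_left h3 (by positivity)
    · intro s hs
      -- The growth in s splits into R^n, cancelled by the first exponential, and a power of |Im(s -
      -- z)|, absorbed by the Gaussian.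
      have h1 : 1 + |s.im| ≤ R * (1 + |s.im - z.im|) := by
        have : |s.im| ≤ |s.im - z.im| + |z.im| := by
          simpa using abs_add_le (s.im - z.im) z.im
        rw [hR]
        nlinarith [abs_nonneg (s.im - z.im), abs_nonneg z.im]
      have h2 : (1 + |s.im|) ^ n ≤ R ^ n * (1 + |s.im - z.im|) ^ n := by
        rw [← mul_pow]
        exact pow_le_pow_left₀ (by positivity) h1 n
      have h3 : R ^ (κ * (s.re - r)) = (R ^ n)⁻¹ := by
        rw [hs, hκ, show (n : ℝ) / (r - l) * (l - r) = -(n : ℝ) by field_simp; ring,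
          Real.rpow_neg hR0.le, Real.rpow_natCast]
      have h4 := one_add_pow_mul_exp_le n (abs_nonneg (s.im - z.im))
      simp only [hH, norm_mul]
      rw [hpow, h3]
      calc ‖F s‖ * ((R ^ n)⁻¹ * ‖Complex.exp ((s - z) ^ 2)‖)
          ≤ (A * (R ^ n * (1 + |s.im - z.im|) ^ n)) *
            ((R ^ n)⁻¹ * (E * Real.exp (-|s.im - z.im| ^ 2))) := by
            refine mul_le_mul ((hl s hs).trans (mul_le_mul_of_nonneg_left h2 hA))
              (mul_le_mul_of_nonneg_left (norm_exp_sub_sq_le hs.ge (hs.le.trans hlr.le) hz hz')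
                (by positivity)) (by positivity) (by positivity)
        _ = A * E * ((1 + |s.im - z.im|) ^ n * Real.exp (-|s.im - z.im| ^ 2)) := by
            field_simp
        _ ≤ _ := mul_le_mul_of_nonneg_left h4 (by positivity)
    · intro s hs
      simp only [hH, norm_mul]
      rw [hpow]
      calc ‖F s‖ * (R ^ (κ * (s.re - r)) * ‖Complex.exp ((s - z) ^ 2)‖)
          ≤ A * (1 * E) :=
            mul_le_mul (hr s hs) (mul_le_mul (hle1 s hs.le) (hexp1 s (hlr.le.trans hs.ge) hs.le)
              (norm_nonneg _) zero_le_one) (by positivity) hA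
        _ = A * E * 1 := by ring
        _ ≤ _ := mul_le_mul_of_nonneg_left hfac (by positivity)
  have hHz : ‖H z‖ = ‖F z‖ * R ^ (κ * (z.re - r)) := by
    simp only [hH, norm_mul]
    rw [hpow]
    simp
  rw [hHz] at key
  have e : R ^ (κ * (z.re - r)) = (R ^ (κ * (r - z.re)))⁻¹ := by
    rw [← Real.rpow_neg hR0.le]; ring_nf
  rw [e, ← div_eq_mul_inv, div_le_iff₀ (Real.rpow_pos_of_pos hR0 _)] at key
  exact key

/-! ### Growth of the archimedean factor. -/

theorem norm_complexGamma_le {z : ℂ} (hz : 0 < z.re) : ‖Complex.Gamma z‖ ≤ Real.Gamma z.re := by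
  rw [Complex.Gamma_eq_integral hz, Real.Gamma_eq_integral hz, Complex.GammaIntegral]
  refine (norm_integral_le_integral_norm _).trans (le_of_eq ?_)
  refine setIntegral_congr_fun measurableSet_Ioi fun x hx => ?_
  have hx0 : 0 < x := hx
  rw [norm_mul, Complex.norm_cpow_eq_rpow_re_of_pos hx0, Complex.norm_real, Real.norm_eq_abs,
    abs_of_pos (Real.exp_pos _), Complex.sub_re, Complex.one_re]

theorem norm_complexSin_le (z : ℂ) : ‖Complex.sin z‖ ≤ Real.exp |z.im| := by
  have h1 : ‖Complex.exp (-z * Complex.I)‖ ≤ Real.exp |z.im| := by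
    rw [Complex.norm_exp]
    refine Real.exp_le_exp.2 ?_
    simpa using le_abs_self z.im
  have h2 : ‖Complex.exp (z * Complex.I)‖ ≤ Real.exp |z.im| := by
    rw [Complex.norm_exp]
    refine Real.exp_le_exp.2 ?_
    simpa using neg_le_abs z.im
  rw [Complex.sin, norm_div, norm_mul, Complex.norm_I, mul_one, Complex.norm_ofNat,
    div_le_iff₀ two_pos]
  refine (norm_sub_le _ _).trans ?_
  linarith

theorem differentiable_inv_gammaFactor : Differentiable ℂ fun s => (gammaFactor s)⁻¹ := by
  have hpi : (Real.pi : ℂ) ≠ 0 := by exact_mod_cast Real.pi_ne_zero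
  have h : (fun s => (gammaFactor s)⁻¹) = fun s : ℂ =>
      2 * (Real.pi : ℂ) ^ (s / 2) * (Complex.Gamma (s / 2 + 1))⁻¹ := by
    funext s
    rw [gammaFactor, mul_inv, mul_inv, inv_inv, neg_div, Complex.cpow_neg, inv_inv]
  rw [h]
  refine Differentiable.mul ?_ (Complex.differentiable_one_div_Gamma.comp (by fun_prop))
  intro s
  exact ((differentiableAt_id.div_const 2).const_cpow (Or.inl hpi)).const_mul 2

theorem norm_pi_cpow (s : ℂ) : ‖(Real.pi : ℂ) ^ s‖ = Real.pi ^ s.re :=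
  Complex.norm_cpow_eq_rpow_re_of_pos Real.pi_pos s

/-- By reflection, 1/Γ(s/2) = Γ(1-s/2)sin(πs/2)/π. For Re s ≤ 1 the Gamma value has real part in a
compact subset of [1/2, ∞) and is bounded, while the sine grows at most like exp(π|τ|/2). This crude
bound is all that Phragmén–Lindelöf needs. -/
theorem exists_norm_inv_gammaFactor_le {l r : ℝ} (hr : r ≤ 1) :
    ∃ C : ℝ, 0 ≤ C ∧ ∀ s : ℂ, l ≤ s.re → s.re ≤ r → 1 ≤ |s.im| →
      ‖(gammaFactor s)⁻¹‖ ≤ C * Real.exp (2 * |s.im|) := by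
  have hpi : (Real.pi : ℂ) ≠ 0 := by exact_mod_cast Real.pi_ne_zero
  have hc : ContinuousOn Real.Gamma (Icc (1 / 2) (1 - l / 2)) := fun x hx =>
    (Real.differentiableAt_Gamma (fun m => by
      have h1 : (0 : ℝ) ≤ m := Nat.cast_nonneg m
      have h2 := hx.1
      intro h; rw [h] at h2; linarith)).continuousAt.continuousWithinAt
  obtain ⟨M, hM⟩ := isCompact_Icc.exists_bound_of_continuousOn hc
  set M' := max M 0 with hM'
  have hM0 : 0 ≤ M' := le_max_right _ _
  refine ⟨2 * Real.pi ^ (1 / 2 : ℝ) * (2 * M'), by positivity, fun s hs hs' him => ?_⟩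
  have hs0 : s / 2 ≠ 0 := by
    intro h
    have := congrArg Complex.im h
    simp only [Complex.div_ofNat_im, Complex.zero_im] at this
    have h0 : s.im = 0 := by linarith
    rw [h0] at him
    norm_num at him
  have hsin : Complex.sin (Real.pi * (s / 2)) ≠ 0 := by
    rw [Complex.sin_ne_zero_iff]
    intro k hk
    have := congrArg Complex.im hk
    simp only [Complex.mul_im, Complex.div_ofNat_im, Complex.div_ofNat_re, Complex.ofReal_re,
      Complex.ofReal_im, Complex.intCast_re, Complex.intCast_im] at this
    have h0 : s.im = 0 := by
      have h3 : Real.pi * s.im = 0 := by linarith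
      exact (mul_eq_zero.1 h3).resolve_left Real.pi_ne_zero
    rw [h0] at him
    norm_num at him
  have hrefl := Complex.Gamma_mul_Gamma_one_sub (s / 2)
  have hG : Complex.Gamma (s / 2) * Complex.Gamma (1 - s / 2) ≠ 0 := by
    rw [hrefl]; exact div_ne_zero hpi hsin
  have hinv : (gammaFactor s)⁻¹ = 2 * (Real.pi : ℂ) ^ (s / 2) * ((s / 2)⁻¹ *
      (Complex.Gamma (1 - s / 2) * Complex.sin (Real.pi * (s / 2)) * (Real.pi : ℂ)⁻¹)) := by
    have h1 : (Complex.Gamma (s / 2))⁻¹ =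
        Complex.Gamma (1 - s / 2) * Complex.sin (Real.pi * (s / 2)) * (Real.pi : ℂ)⁻¹ := by
      rw [eq_div_iff hsin] at hrefl
      refine (eq_inv_of_mul_eq_one_left ?_).symm
      linear_combination (Real.pi : ℂ)⁻¹ * hrefl + mul_inv_cancel₀ hpi
    rw [gammaFactor, Complex.Gamma_add_one _ hs0, mul_inv, mul_inv, mul_inv, inv_inv, neg_div,
      Complex.cpow_neg, inv_inv, h1]
  have b1 : ‖(Real.pi : ℂ) ^ (s / 2)‖ ≤ Real.pi ^ (1 / 2 : ℝ) := by
    rw [norm_pi_cpow]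
    refine Real.rpow_le_rpow_of_exponent_le (by linarith [Real.pi_gt_three]) ?_
    simp only [Complex.div_ofNat_re]
    linarith
  have b2 : ‖(s / 2)⁻¹‖ ≤ 2 := by
    have : 1 ≤ ‖s‖ := him.trans (Complex.abs_im_le_norm s)
    rw [norm_inv, norm_div, Complex.norm_ofNat, inv_div]
    exact (div_le_self zero_le_two this)
  have b3 : ‖Complex.Gamma (1 - s / 2)‖ ≤ M' := by
    have hre : (1 - s / 2).re = 1 - s.re / 2 := by simp
    have hp : 0 < (1 - s / 2).re := by rw [hre]; linarith
    refine (norm_complexGamma_le hp).trans ?_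
    rw [hre]
    exact ((le_abs_self _).trans (hM _ ⟨by linarith, by linarith⟩)).trans (le_max_left _ _)
  have b4 : ‖Complex.sin (Real.pi * (s / 2))‖ ≤ Real.exp (2 * |s.im|) := by
    refine (norm_complexSin_le _).trans (Real.exp_le_exp.2 ?_)
    have : (Real.pi * (s / 2)).im = Real.pi / 2 * s.im := by
      simp [Complex.mul_im]; ring
    rw [this, abs_mul, abs_of_pos (by positivity)]
    refine mul_le_mul_of_nonneg_right ?_ (abs_nonneg _)
    linarith [Real.pi_le_four]
  have b5 : ‖(Real.pi : ℂ)⁻¹‖ ≤ 1 := by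
    rw [norm_inv, Complex.norm_real, Real.norm_eq_abs, abs_of_pos Real.pi_pos]
    exact inv_le_one_of_one_le₀ (by linarith [Real.pi_gt_three])
  rw [hinv]
  simp only [norm_mul, Complex.norm_ofNat]
  calc _ ≤ 2 * Real.pi ^ (1 / 2 : ℝ) * (2 * (M' * Real.exp (2 * |s.im|) * 1)) := by gcongr
    _ = _ := by ring

/-- Iterating Γ(w+1) = wΓ(w) gives polynomial bounds on Gamma quotients at integer shifts without
Stirling's formula. -/
theorem norm_Gamma_add_nat_le (w : ℂ) (n : ℕ) (hw : ∀ j : ℕ, w + j ≠ 0) :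
    ‖Complex.Gamma (w + n)‖ ≤ (‖w‖ + n) ^ n * ‖Complex.Gamma w‖ := by
  induction n with
  | zero => simp
  | succ n ih =>
    have h1 : w + ((n + 1 : ℕ) : ℂ) = (w + n) + 1 := by push_cast; ring
    rw [h1, Complex.Gamma_add_one _ (hw n), norm_mul]
    have h2 : ‖w + n‖ ≤ ‖w‖ + n := by
      simpa using norm_add_le w (n : ℂ)
    have h3 : ‖w‖ + n ≤ ‖w‖ + ((n + 1 : ℕ) : ℝ) := by push_cast; linarith
    calc ‖w + n‖ * ‖Complex.Gamma (w + n)‖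
        ≤ (‖w‖ + ((n + 1 : ℕ) : ℝ)) * ((‖w‖ + ((n + 1 : ℕ) : ℝ)) ^ n * ‖Complex.Gamma w‖) := by
          refine mul_le_mul (h2.trans h3) (ih.trans ?_) (norm_nonneg _) (by positivity)
          gcongr
      _ = _ := by rw [pow_succ]; ring

theorem gammaFactor_ne_zero {s : ℂ} (hs : ∀ m : ℕ, s / 2 + 1 ≠ -m) : gammaFactor s ≠ 0 := by
  have hpi : (Real.pi : ℂ) ≠ 0 := by exact_mod_cast Real.pi_ne_zero
  refine mul_ne_zero (mul_ne_zero (by norm_num) ?_) (Complex.Gamma_ne_zero hs)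
  simp [Complex.cpow_eq_zero_iff, hpi]

theorem gammaFactor_ne_zero_of_re_pos {s : ℂ} (hs : 0 < s.re) : gammaFactor s ≠ 0 := by
  refine gammaFactor_ne_zero fun m h => ?_
  have := congrArg Complex.re h
  simp at this
  have h1 : (0 : ℝ) ≤ m := Nat.cast_nonneg m
  linarith

/-- On the line `Re s = 1/2 - n`, the quotient of archimedean factors of the functional equation is
of polynomial growth of degree `n`. -/
theorem exists_norm_gammaFactor_one_sub_le (n : ℕ) :
    ∃ C : ℝ, 0 ≤ C ∧ ∀ s : ℂ, s.re = 1 / 2 - n →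
      ‖gammaFactor (1 - s) * (gammaFactor s)⁻¹‖ ≤ C * (1 + |s.im|) ^ n := by
  refine ⟨(5 / 4 + 2 * n) ^ n, by positivity, fun s hs => ?_⟩
  -- On Re s = 1/2 - n, the argument (1-s)/2+1 is exactly the conjugate of s/2+1 shifted by n, and
  -- conjugation preserves |Γ|.
  set w : ℂ := (starRingEnd ℂ) (s / 2 + 1) with hw
  have hwre : w.re = 5 / 4 - n / 2 := by
    rw [hw, Complex.conj_re]; simp [hs]; ring
  have hwim : w.im = -(s.im / 2) := by
    rw [hw, Complex.conj_im]; simp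
  have hne : ∀ j : ℕ, w + j ≠ 0 := fun j h => by
    have h1 := congrArg Complex.re h
    simp only [Complex.add_re, hwre, Complex.natCast_re, Complex.zero_re] at h1
    -- Parity excludes the poles: 5 + 4j is odd and 2n is even.
    have h2 : (5 : ℝ) + 4 * j = 2 * n := by linarith
    have h3 : 5 + 4 * j = 2 * n := by exact_mod_cast h2
    omega
  have hs1 : (1 - s) / 2 + 1 = w + n := by
    apply Complex.ext
    · simp [hwre, hs]; ring
    · simp [hwim]; ring
  have hG := norm_Gamma_add_nat_le w n hne
  have hGw : ‖Complex.Gamma w‖ = ‖Complex.Gamma (s / 2 + 1)‖ := by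
    rw [hw, Complex.Gamma_conj, RCLike.norm_conj]
  have hGpos : 0 < ‖Complex.Gamma (s / 2 + 1)‖ := by
    rw [← hGw, norm_pos_iff]
    refine Complex.Gamma_ne_zero fun m h => hne m ?_
    rw [h]; ring
  have hwn : ‖w‖ + n ≤ (5 / 4 + 2 * n) * (1 + |s.im|) := by
    have h1 := Complex.norm_le_abs_re_add_abs_im w
    have h2 : |w.re| ≤ 5 / 4 + n / 2 := by
      rw [hwre]
      have : (0 : ℝ) ≤ n := Nat.cast_nonneg n
      exact abs_le.2 ⟨by linarith, by linarith⟩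
    have h3 : |w.im| ≤ |s.im| := by
      rw [hwim, abs_neg, abs_div, abs_two]
      linarith [abs_nonneg s.im]
    have h4 : (0 : ℝ) ≤ n := Nat.cast_nonneg n
    nlinarith [abs_nonneg s.im]
  have hpi1 : ‖(Real.pi : ℂ) ^ (-(1 - s) / 2)‖ ≤ ‖(Real.pi : ℂ) ^ (-s / 2)‖ := by
    rw [norm_pi_cpow, norm_pi_cpow]
    refine Real.rpow_le_rpow_of_exponent_le (by linarith [Real.pi_gt_three]) ?_
    have h4 : (0 : ℝ) ≤ n := Nat.cast_nonneg n
    simp only [Complex.div_ofNat_re, Complex.neg_re, Complex.sub_re, Complex.one_re, hs]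
    linarith
  have hpi0 : 0 < ‖(Real.pi : ℂ) ^ (-s / 2)‖ := by
    rw [norm_pi_cpow]; exact Real.rpow_pos_of_pos Real.pi_pos _
  rw [norm_mul, norm_inv, ← div_eq_mul_inv, gammaFactor, gammaFactor, norm_mul, norm_mul, norm_mul,
    norm_mul, hs1, div_le_iff₀ (mul_pos (mul_pos (by simp) hpi0) hGpos)]
  calc ‖(2⁻¹ : ℂ)‖ * ‖(Real.pi : ℂ) ^ (-(1 - s) / 2)‖ * ‖Complex.Gamma (w + n)‖
      ≤ ‖(2⁻¹ : ℂ)‖ * ‖(Real.pi : ℂ) ^ (-s / 2)‖ *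
        (((5 / 4 + 2 * n) * (1 + |s.im|)) ^ n * ‖Complex.Gamma (s / 2 + 1)‖) := by
        refine mul_le_mul (mul_le_mul_of_nonneg_left hpi1 (norm_nonneg _)) ?_ (norm_nonneg _)
          (by positivity)
        rw [← hGw]
        refine hG.trans (mul_le_mul_of_nonneg_right ?_ (norm_nonneg _))
        exact pow_le_pow_left₀ (by positivity) hwn n
    _ = _ := by rw [mul_pow]; ring

/-! ### Meromorphic continuation and the L-Property. -/

section

variable {a : ℝ} {f : K}

theorem memLp_coe (f : K) : MemLp (f : ℝ → ℂ) 2 (volume.restrict (Ioi 0)) := Lp.memLp f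

/-- The functional equation pair formed by the theta integrals of `f` and of its cosine
transform. -/
noncomputable def thetaPair (ha : 0 < a) (hf : f ∈ L a) : WeakFEPair ℂ where
  f := theta f
  g := theta (cosineTransform f)
  k := 1
  ε := 1
  f₀ := 0
  g₀ := 0
  hf_int := (continuousOn_theta (memLp_coe f)).locallyIntegrableOn measurableSet_Ioi
  hg_int := (continuousOn_theta (memLp_coe _)).locallyIntegrableOn measurableSet_Ioi
  hk := one_pos
  hε := one_ne_zero
  h_feq x hx := by rw [theta_one_div f hx]; simp
  hf_top r := by
    obtain ⟨c, hc⟩ := hf.1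
    simpa using theta_isBigO (memLp_coe f) ha hc r
  hg_top r := by
    obtain ⟨c, hc⟩ := hf.2
    simpa using theta_isBigO (memLp_coe _) ha hc r

/-- The constant terms at infinity vanish on both sides, so the Mellin integral converges for every
s and is entire. -/
theorem isStrongFEPair_thetaPair (ha : 0 < a) (hf : f ∈ L a) :
    IsStrongFEPair (thetaPair ha hf) := ⟨rfl, rfl⟩

theorem mellinConvergent_theta (ha : 0 < a) (hf : f ∈ L a) (s : ℂ) :
    MellinConvergent (theta f) s :=
  ((isStrongFEPair_thetaPair ha hf).hasMellin s).1

theorem differentiable_mellin_theta (ha : 0 < a) (hf : f ∈ L a) :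
    Differentiable ℂ (mellin (theta f)) := by
  have h := (isStrongFEPair_thetaPair ha hf).differentiable_Λ
  rwa [(isStrongFEPair_thetaPair ha hf).Λ_eq] at h

theorem mellin_theta_eq_one_sub (ha : 0 < a) (hf : f ∈ L a) (s : ℂ) :
    mellin (theta f) s = mellin (theta (cosineTransform f)) (1 - s) := by
  have h := (thetaPair ha hf).functional_equation (1 - s)
  rw [(isStrongFEPair_thetaPair ha hf).Λ_eq, (isStrongFEPair_thetaPair ha hf).symm_Λ_eq] at h
  simpa [thetaPair] using h

theorem exists_norm_mellin_theta_le (ha : 0 < a) (hf : f ∈ L a) (l r : ℝ) :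
    ∃ C : ℝ, 0 ≤ C ∧ ∀ s : ℂ, l ≤ s.re → s.re ≤ r → ‖mellin (theta f) s‖ ≤ C := by
  have h1 : IntegrableOn (fun x : ℝ => ‖(x : ℂ) ^ ((l : ℂ) - 1) • theta f x‖) (Ioi 0) :=
    (mellinConvergent_theta ha hf l).norm
  have h2 : IntegrableOn (fun x : ℝ => ‖(x : ℂ) ^ ((r : ℂ) - 1) • theta f x‖) (Ioi 0) :=
    (mellinConvergent_theta ha hf r).norm
  refine ⟨∫ x in Ioi (0 : ℝ), (‖(x : ℂ) ^ ((l : ℂ) - 1) • theta f x‖ +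
    ‖(x : ℂ) ^ ((r : ℂ) - 1) • theta f x‖), integral_nonneg fun x => by positivity,
    fun s hs hs' => norm_integral_le_of_norm_le (h1.add h2) ?_⟩
  filter_upwards [ae_restrict_mem measurableSet_Ioi] with x hx
  have hx0 : 0 < x := hx
  simp only [norm_smul, Complex.norm_cpow_eq_rpow_re_of_pos hx0, Complex.sub_re, Complex.one_re,
    Complex.ofReal_re]
  rw [← add_mul]
  refine mul_le_mul_of_nonneg_right ?_ (norm_nonneg _)
  rcases le_total 1 x with h | h
  · exact (Real.rpow_le_rpow_of_exponent_le h (by linarith)).trans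
      (le_add_of_nonneg_left (by positivity))
  · exact (Real.rpow_le_rpow_of_exponent_ge hx0 h (by linarith)).trans
      (le_add_of_nonneg_right (by positivity))

/-- The entire function `(s - 1) f^(s)`. -/
noncomputable def mellinNumerator (f : ℝ → ℂ) (s : ℂ) : ℂ :=
  mellin (theta f) s * (gammaFactor s)⁻¹

/-- The meromorphic continuation of the right Mellin transform of `f`. -/
noncomputable def mellinContinuation (f : ℝ → ℂ) (s : ℂ) : ℂ :=
  -- Away from 1 this is the numerator divided by s-1. At s = 1 the quotient is 0 by convention, so
  -- a removable singularity is filled with the derivative.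
  dslope (mellinNumerator f) 1 s + mellinNumerator f 1 / (s - 1)

theorem differentiable_mellinNumerator (ha : 0 < a) (hf : f ∈ L a) :
    Differentiable ℂ (mellinNumerator f) :=
  (differentiable_mellin_theta ha hf).mul differentiable_inv_gammaFactor

theorem mellinContinuation_of_ne (f : ℝ → ℂ) {s : ℂ} (hs : s ≠ 1) :
    mellinContinuation f s = mellinNumerator f s / (s - 1) := by
  rw [mellinContinuation, dslope_of_ne _ hs, slope_def_field]
  ring

theorem mellinNumerator_of_half_lt_re (ha : 0 < a) {c : ℂ}
    (hc : ∀ᵐ t ∂(volume.restrict (Ioo (0 : ℝ) a)), (f : ℝ → ℂ) t = c) {s : ℂ}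
    (hs : 1 / 2 < s.re) :
    mellinNumerator f s = (s - 1) * tailMellin a f s - c * (a : ℂ) ^ (1 - s) := by
  rw [mellinNumerator, mellin_theta (memLp_coe f) ha hc hs]
  field_simp [gammaFactor_ne_zero_of_re_pos (s := s) (by linarith)]

/-- The residue at 1 is minus the constant value of `f` near 0, so the pole is absent exactly when c
= 0. -/
theorem mellinNumerator_one (ha : 0 < a) {c : ℂ}
    (hc : ∀ᵐ t ∂(volume.restrict (Ioo (0 : ℝ) a)), (f : ℝ → ℂ) t = c) :
    mellinNumerator f 1 = -c := by
  rw [mellinNumerator_of_half_lt_re ha hc (by norm_num)]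
  simp

theorem mellinContinuation_of_half_lt_re (ha : 0 < a) {c : ℂ}
    (hc : ∀ᵐ t ∂(volume.restrict (Ioo (0 : ℝ) a)), (f : ℝ → ℂ) t = c) {s : ℂ}
    (hs : 1 / 2 < s.re) (hs1 : s ≠ 1) :
    mellinContinuation f s = tailMellin a f s + c * (a : ℂ) ^ (1 - s) / (1 - s) := by
  rw [mellinContinuation_of_ne _ hs1, mellinNumerator_of_half_lt_re ha hc hs]
  have h1 : s - 1 ≠ 0 := sub_ne_zero.2 hs1
  have h2 : 1 - s ≠ 0 := sub_ne_zero.2 hs1.symm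
  rw [← neg_sub s 1, div_neg, sub_div, mul_div_cancel_left₀ _ h1, sub_eq_add_neg]

theorem differentiable_dslope_mellinNumerator (ha : 0 < a) (hf : f ∈ L a) :
    Differentiable ℂ (dslope (mellinNumerator f) 1) := by
  rw [← differentiableOn_univ, Complex.differentiableOn_dslope univ_mem, differentiableOn_univ]
  exact differentiable_mellinNumerator ha hf

theorem analyticAt_mellinContinuation (ha : 0 < a) (hf : f ∈ L a) {s : ℂ} (hs : s ≠ 1) :
    AnalyticAt ℂ (mellinContinuation f) s := by
  refine ((differentiable_dslope_mellinNumerator ha hf).analyticAt s).add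
    (analyticAt_const.div (by fun_prop) (sub_ne_zero.2 hs))

theorem meromorphic_mellinContinuation (ha : 0 < a) (hf : f ∈ L a) :
    Meromorphic (mellinContinuation f) := fun s =>
  ((differentiable_dslope_mellinNumerator ha hf).analyticAt s).meromorphicAt.add
    ((MeromorphicAt.const _ s).div (by fun_prop))

theorem notMem_poles_of_analyticAt {F : ℂ → ℂ} {s : ℂ} (h : AnalyticAt ℂ F s) : s ∉ poles F :=
  not_lt.2 h.meromorphicOrderAt_nonneg

theorem poles_mellinContinuation_subset (ha : 0 < a) (hf : f ∈ L a) :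
    poles (mellinContinuation f) ⊆ {1} := fun s hs => by
  by_contra h
  exact notMem_poles_of_analyticAt (analyticAt_mellinContinuation ha hf h) hs

theorem one_mem_poles_mellinContinuation (ha : 0 < a) (hf : f ∈ L a)
    (h1 : mellinNumerator f 1 ≠ 0) : 1 ∈ poles (mellinContinuation f) := by
  refine (tendsto_cobounded_iff_meromorphicOrderAt_neg
    (meromorphic_mellinContinuation ha hf 1)).1 ?_
  rw [← tendsto_norm_atTop_iff_cobounded]
  have e : (fun s => ‖mellinNumerator f s‖ * ‖(s - 1)⁻¹‖) =ᶠ[𝓝[≠] (1 : ℂ)]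
      fun s => ‖mellinContinuation f s‖ := by
    filter_upwards [self_mem_nhdsWithin] with s hs
    rw [mellinContinuation_of_ne _ hs, div_eq_mul_inv, norm_mul]
  refine Tendsto.congr' e (Tendsto.pos_mul_atTop (norm_pos_iff.2 h1) ?_ ?_)
  · exact ((differentiable_mellinNumerator ha hf).continuous.norm.tendsto 1).mono_left
      nhdsWithin_le_nhds
  · rw [tendsto_norm_atTop_iff_cobounded]
    refine tendsto_inv₀_nhdsNE_zero.comp ?_
    refine tendsto_nhdsWithin_of_tendsto_nhds_of_eventually_within _ ?_ ?_
    · have : Tendsto (fun s : ℂ => s - 1) (𝓝 1) (𝓝 (1 - 1)) :=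
        (continuous_id.sub continuous_const).tendsto 1
      rw [sub_self] at this
      exact this.mono_left nhdsWithin_le_nhds
    · filter_upwards [self_mem_nhdsWithin] with s hs
      exact sub_ne_zero.2 hs

theorem isMeromorphicFunction_mellinContinuation (ha : 0 < a) (hf : f ∈ L a) :
    IsMeromorphicFunction (mellinContinuation f) := by
  refine ⟨meromorphic_mellinContinuation ha hf, fun s hs => ?_⟩
  rcases eq_or_ne s 1 with rfl | h
  · have h0 : mellinNumerator f 1 = 0 := by
      by_contra h1
      exact hs (one_mem_poles_mellinContinuation ha hf h1)
    have : mellinContinuation f = dslope (mellinNumerator f) 1 := by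
      funext s
      rw [mellinContinuation, h0, zero_div, add_zero]
    rw [this]
    exact (differentiable_dslope_mellinNumerator ha hf).analyticAt 1
  · exact analyticAt_mellinContinuation ha hf h

/-- Boundedness of the right Mellin transform to the right of the critical line. -/
theorem exists_norm_mellinContinuation_le (ha : 0 < a) (hf : f ∈ L a) {σ : ℝ} (hσ : 1 / 2 < σ)
    (β : ℝ) {δ : ℝ} (hδ : 0 < δ) :
    ∃ C : ℝ, 0 ≤ C ∧ ∀ s : ℂ, σ ≤ s.re → s.re ≤ β →
      (mellinNumerator f 1 = 0 ∨ δ ≤ ‖s - 1‖) → ‖mellinContinuation f s‖ ≤ C := by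
  obtain ⟨c, hc⟩ := hf.1
  obtain ⟨B, hB0, hB⟩ := exists_norm_tailMellin_le (memLp_coe f) ha hσ β
  set M := a ^ (1 - σ) + a ^ (1 - β) with hM
  have hM0 : 0 ≤ M := by positivity
  -- The first term covers s = 1, which the hypotheses allow only when there is no pole; the
  -- explicit formula does not apply there.
  refine ⟨‖mellinContinuation f 1‖ + (B + ‖c‖ * M / δ), by positivity, fun s h1 h2 h3 => ?_⟩
  rcases eq_or_ne s 1 with rfl | hs
  · exact le_add_of_nonneg_right (by positivity)
  refine le_trans ?_ (le_add_of_nonneg_left (norm_nonneg _))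
  rw [mellinContinuation_of_half_lt_re ha hc (by linarith) hs]
  refine (norm_add_le _ _).trans (add_le_add (hB s h1 h2) ?_)
  rw [norm_div, norm_mul]
  rcases eq_or_ne c 0 with rfl | hc0
  · simp
  have hδs : δ ≤ ‖1 - s‖ := by
    rw [norm_sub_rev]
    refine h3.resolve_left ?_
    rw [mellinNumerator_one ha hc]
    exact neg_ne_zero.2 hc0
  have hpow : ‖(a : ℂ) ^ (1 - s)‖ ≤ M := by
    rw [Complex.norm_cpow_eq_rpow_re_of_pos ha, Complex.sub_re, Complex.one_re, hM]
    rcases le_total 1 a with h | h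
    · exact (Real.rpow_le_rpow_of_exponent_le h (by linarith)).trans
        (le_add_of_nonneg_right (by positivity))
    · exact (Real.rpow_le_rpow_of_exponent_ge ha h (by linarith)).trans
        (le_add_of_nonneg_left (by positivity))
  gcongr

/-- Polynomial growth on the vertical line `Re s = 1/2 - n`. -/
theorem exists_norm_mellinContinuation_line_le (ha : 0 < a) (hf : f ∈ L a) {n : ℕ} (hn : n ≠ 0) :
    ∃ C : ℝ, 0 ≤ C ∧ ∀ s : ℂ, s.re = 1 / 2 - n →
      ‖mellinContinuation f s‖ ≤ C * (1 + |s.im|) ^ n := by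
  obtain ⟨d, hd⟩ := hf.2
  have hn1 : (1 : ℝ) ≤ n := by exact_mod_cast Nat.one_le_iff_ne_zero.2 hn
  obtain ⟨B, hB0, hB⟩ := exists_norm_tailMellin_le (memLp_coe (cosineTransform f)) ha
    (σ := 1 / 2 + n) (by linarith) (1 / 2 + n)
  obtain ⟨Γ, hΓ0, hΓ⟩ := exists_norm_gammaFactor_one_sub_le n
  set M := ‖d‖ * a ^ (1 / 2 - n : ℝ) with hM
  have hM0 : 0 ≤ M := by positivity
  refine ⟨Γ * (3 * B + 2 * M), by positivity, fun s hs => ?_⟩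
  have hs1 : s ≠ 1 := by
    rintro rfl
    simp only [Complex.one_re] at hs
    linarith
  have hnorm : 1 / 2 ≤ ‖s - 1‖ := by
    have := Complex.abs_re_le_norm (s - 1)
    rw [Complex.sub_re, Complex.one_re, hs] at this
    have h2 := neg_le_abs ((1 : ℝ) / 2 - n - 1)
    linarith
  have hpos : 0 < ‖s - 1‖ := by linarith
  have hre : (1 - s).re = 1 / 2 + n := by
    rw [Complex.sub_re, Complex.one_re, hs]; ring
  -- The functional equation moves to Re(1-s) = 1/2+n, where the explicit formula for the cosine
  -- transform is available.
  rw [mellinContinuation_of_ne _ hs1, mellinNumerator, mellin_theta_eq_one_sub ha hf,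
    mellin_theta (memLp_coe (cosineTransform f)) ha hd (by rw [hre]; linarith)]
  have h1 : ‖(1 - s - 1) * tailMellin a (cosineTransform f) (1 - s) - d * (a : ℂ) ^ (1 - (1 - s))‖
      ≤ ‖s‖ * B + M := by
    refine (norm_sub_le _ _).trans (add_le_add ?_ (le_of_eq ?_))
    · rw [norm_mul, show 1 - s - 1 = -s by ring, norm_neg]
      exact mul_le_mul_of_nonneg_left (hB _ hre.ge hre.le) (norm_nonneg _)
    · rw [norm_mul, Complex.norm_cpow_eq_rpow_re_of_pos ha, sub_sub_cancel, hs]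
  -- Since ‖s-1‖ ≥ 1/2, one has ‖s‖ ≤ 3‖s-1‖ and 1 ≤ 2‖s-1‖; the factor ‖s-1‖ then cancels the
  -- denominator.
  have h2 : ‖s‖ * B + M ≤ (3 * B + 2 * M) * ‖s - 1‖ := by
    have h3 : ‖s‖ ≤ ‖s - 1‖ + 1 := by
      simpa using norm_add_le (s - 1) 1
    nlinarith
  rw [norm_div, div_le_iff₀ hpos]
  calc _ = ‖gammaFactor (1 - s) * (gammaFactor s)⁻¹‖ *
        ‖(1 - s - 1) * tailMellin a (cosineTransform f) (1 - s) -
          d * (a : ℂ) ^ (1 - (1 - s))‖ := by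
        simp only [norm_mul]; ring
    _ ≤ (Γ * (1 + |s.im|) ^ n) * ((3 * B + 2 * M) * ‖s - 1‖) :=
        mul_le_mul (hΓ s hs) (h1.trans h2) (norm_nonneg _) (by positivity)
    _ = _ := by ring

/-- The convexity bound in a strip around and to the left of the critical line. -/
theorem exists_norm_mellinContinuation_strip_le (ha : 0 < a) (hf : f ∈ L a) {n : ℕ} (hn : n ≠ 0)
    {η : ℝ} (hη : 0 < η) (hη' : η ≤ 1 / 4) :
    ∃ C : ℝ, 0 ≤ C ∧ ∀ s : ℂ, 1 / 2 - n ≤ s.re → s.re ≤ 1 / 2 + η →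
      ‖mellinContinuation f s‖ ≤ C * (1 + |s.im|) ^ (1 / 2 + η - s.re) := by
  have hn1 : (1 : ℝ) ≤ n := by exact_mod_cast Nat.one_le_iff_ne_zero.2 hn
  obtain ⟨A₁, hA₁0, hA₁⟩ := exists_norm_mellinContinuation_le ha hf (σ := 1 / 2 + η) (by linarith)
    (1 / 2 + η) (δ := 1 / 4) (by norm_num)
  obtain ⟨A₂, hA₂0, hA₂⟩ := exists_norm_mellinContinuation_line_le ha hf hn
  obtain ⟨M, hM0, hM⟩ := exists_norm_mellin_theta_le ha hf (1 / 2 - n) (1 / 2 + η)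
  obtain ⟨Γ, hΓ0, hΓ⟩ := exists_norm_inv_gammaFactor_le (l := 1 / 2 - n) (r := 1 / 2 + η)
    (by linarith)
  have hlr : (1 / 2 - n : ℝ) < 1 / 2 + η := by linarith
  -- As η ≤ 1/4, the strip stays at distance at least 1/4 from the possible pole at 1.
  have hnorm : ∀ s : ℂ, s.re ≤ 1 / 2 + η → 1 / 4 ≤ ‖s - 1‖ := fun s hs => by
    have := Complex.abs_re_le_norm (s - 1)
    rw [Complex.sub_re, Complex.one_re] at this
    have h2 := neg_le_abs (s.re - 1)
    linarith
  have hne : ∀ s : ℂ, s.re ≤ 1 / 2 + η → s ≠ 1 := fun s hs h => by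
    have := hnorm s hs
    rw [h, sub_self, norm_zero] at this
    norm_num at this
  have key : ∃ C : ℝ, 0 ≤ C ∧ ∀ s : ℂ, 1 / 2 - n ≤ s.re → s.re ≤ 1 / 2 + η →
      ‖mellinContinuation f s‖ ≤ C * (1 + |s.im|) ^
        (n / (1 / 2 + η - (1 / 2 - n)) * (1 / 2 + η - s.re)) := by
    refine exists_convexity_bound hlr n (A := max A₁ A₂) (B := 4 * (M * Γ)) ?_ ?_ ?_ ?_
    · refine DifferentiableOn.diffContOnCl fun s hs => ?_
      have hs' : s.re ≤ 1 / 2 + η := by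
        have hcl : IsClosed (Complex.re ⁻¹' Iic (1 / 2 + η : ℝ)) :=
          isClosed_Iic.preimage Complex.continuous_re
        exact closure_minimal (fun z hz => le_of_lt hz.2) hcl hs
      exact (analyticAt_mellinContinuation ha hf (hne s hs')).differentiableAt.differentiableWithinAt
    · intro s hs
      exact (hA₁ s hs.ge hs.le (Or.inr (hnorm s hs.le))).trans (le_max_left _ _)
    · intro s hs
      exact (hA₂ s hs).trans (mul_le_mul_of_nonneg_right (le_max_right _ _) (by positivity))
    · intro s hs hs' him
      have h4 := hnorm s hs'
      rw [mellinContinuation_of_ne _ (hne s hs'), mellinNumerator, norm_div, norm_mul,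
        div_le_iff₀ (by linarith)]
      calc ‖mellin (theta f) s‖ * ‖(gammaFactor s)⁻¹‖
          ≤ M * (Γ * Real.exp (2 * |s.im|)) :=
            mul_le_mul (hM s hs hs') (hΓ s hs hs' him) (norm_nonneg _) hM0
        _ = 4 * (M * Γ) * Real.exp (2 * |s.im|) * (1 / 4) := by ring
        _ ≤ _ := mul_le_mul_of_nonneg_left h4 (by positivity)
  obtain ⟨C, hC0, hC⟩ := key
  refine ⟨C, hC0, fun s hs hs' => (hC s hs hs').trans ?_⟩
  -- The interpolated slope is n/(n+η), which is below 1 and may be replaced by 1.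
  refine mul_le_mul_of_nonneg_left ?_ hC0
  refine Real.rpow_le_rpow_of_exponent_le (by simp) ?_
  refine mul_le_of_le_one_left (by linarith) ?_
  rw [div_le_one (by linarith)]
  linarith

theorem lProperty_mellinContinuation (ha : 0 < a) (hf : f ∈ L a) :
    LProperty (mellinContinuation f) := by
  refine ⟨isMeromorphicFunction_mellinContinuation ha hf,
    (finite_singleton 1).subset (poles_mellinContinuation_subset ha hf), ?_⟩
  intro α β ε δ _ hε hδ
  set η := min ε (1 / 4) with hη
  have hη0 : 0 < η := lt_min hε (by norm_num)
  -- The left edge 1/2-n must lie at or left of α, and n must be nonzero.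
  obtain ⟨n, hn⟩ := exists_nat_ge (max (1 / 2 - α) 1)
  have hnα : 1 / 2 - α ≤ n := (le_max_left _ _).trans hn
  have hn1 : (1 : ℝ) ≤ n := (le_max_right _ _).trans hn
  have hn0 : n ≠ 0 := by
    rintro rfl
    norm_num at hn1
  obtain ⟨A, hA0, hA⟩ := exists_norm_mellinContinuation_strip_le ha hf hn0 hη0 (min_le_right _ _)
  obtain ⟨B, hB0, hB⟩ := exists_norm_mellinContinuation_le ha hf (σ := 1 / 2 + η) (by linarith) β hδ
  refine ⟨A + B, fun s hs hs' hp => ?_⟩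
  have h1 : (1 : ℝ) ≤ 1 + |s.im| := by simp
  have hm : 0 ≤ max (1 / 2 - α) 0 := le_max_right _ _
  have hpow : 1 ≤ (1 + |s.im|) ^ (max (1 / 2 - α) 0 + ε) :=
    Real.one_le_rpow h1 (by linarith)
  rw [add_mul]
  rcases le_total s.re (1 / 2 + η) with h | h
  · refine le_add_of_le_of_nonneg ((hA s (by linarith) h).trans
      (mul_le_mul_of_nonneg_left ?_ hA0)) (by positivity)
    refine Real.rpow_le_rpow_of_exponent_le h1 ?_
    have h2 : η ≤ ε := min_le_left _ _
    have h3 : 1 / 2 - α ≤ max (1 / 2 - α) 0 := le_max_left _ _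
    linarith
  · refine le_add_of_nonneg_of_le (by positivity) ((hB s h hs' ?_).trans
      (le_mul_of_one_le_right hB0 hpow))
    by_cases h0 : mellinNumerator f 1 = 0
    · exact Or.inl h0
    · exact Or.inr (hp 1 (one_mem_poles_mellinContinuation ha hf h0))

/-- The bounds for the Lindelöf exponent that are implied by the L-Property. -/
theorem LProperty.lindelofExponent_le {F : ℂ → ℂ} (hF : LProperty F) (σ : ℝ) :
    lindelofExponent F σ ≤ ((max (1 / 2 - σ) 0 : ℝ) : EReal) := by
  obtain ⟨-, hfin, hbd⟩ := hF
  refine EReal.le_of_forall_lt_iff_le.1 fun z hz => ?_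
  have hz' : max (1 / 2 - σ) 0 < z := by exact_mod_cast hz
  refine sInf_le ⟨z, ?_, rfl⟩
  obtain ⟨C, hC⟩ := hbd σ σ (z - max (1 / 2 - σ) 0) 1 le_rfl (by linarith) one_pos
  have hz0 : 0 ≤ z := (le_max_right _ _).trans hz'.le
  -- T bounds the heights of the finitely many poles, so |τ| ≥ T+1 keeps the point at distance at
  -- least 1 from all of them.
  obtain ⟨T, hT⟩ := (hfin.image fun p => |p.im|).bddAbove
  have hC0 : 0 ≤ max C 0 := le_max_right _ _
  refine IsBigO.of_bound (max C 0 * 2 ^ z) ?_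
  have hev : ∀ᶠ τ : ℝ in cocompact ℝ, max (T + 1) 1 ≤ ‖τ‖ :=
    (tendsto_norm_cocompact_atTop (E := ℝ)).eventually (eventually_ge_atTop _)
  filter_upwards [hev] with τ hτ
  rw [Real.norm_eq_abs] at hτ
  have hτ1 : 1 ≤ |τ| := (le_max_right _ _).trans hτ
  have hτT : T + 1 ≤ |τ| := (le_max_left _ _).trans hτ
  have him : (σ + τ * Complex.I : ℂ).im = τ := by simp
  have hre : (σ + τ * Complex.I : ℂ).re = σ := by simp
  have h := hC (σ + τ * Complex.I) hre.ge hre.le fun p hp => by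
    have h1 : |p.im| ≤ T := hT ⟨p, hp, rfl⟩
    have h2 := Complex.abs_im_le_norm (σ + τ * Complex.I - p)
    rw [Complex.sub_im, him] at h2
    have h3 := abs_sub_abs_le_abs_sub τ p.im
    linarith
  rw [him, add_sub_cancel] at h
  have hpos : 0 ≤ |τ| ^ z := by positivity
  rw [Real.norm_eq_abs, abs_of_nonneg hpos]
  calc _ ≤ C * (1 + |τ|) ^ z := h
    _ ≤ max C 0 * (1 + |τ|) ^ z := mul_le_mul_of_nonneg_right (le_max_left _ _) (by positivity)
    _ ≤ max C 0 * (2 * |τ|) ^ z := by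
        refine mul_le_mul_of_nonneg_left (Real.rpow_le_rpow (by positivity) (by linarith) hz0) hC0
    _ = _ := by rw [Real.mul_rpow two_pos.le (abs_nonneg _)]; ring

end

/-! ### L² limits, Plancherel and scaling. -/

section L2

theorem tendsto_eLpNorm_two_of_dominated {ι α : Type*} [MeasurableSpace α] {μ : Measure α}
    {l : Filter ι} [l.IsCountablyGenerated] {u : ι → α → ℂ} {D : α → ℝ} (hD : MemLp D 2 μ)
    (hu : ∀ᶠ i in l, AEStronglyMeasurable (u i) μ)
    (hb : ∀ᶠ i in l, ∀ᵐ x ∂μ, ‖u i x‖ ≤ D x)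
    (hlim : ∀ᵐ x ∂μ, Tendsto (fun i => u i x) l (𝓝 0)) :
    Tendsto (fun i => eLpNorm (u i) 2 μ) l (𝓝 0) := by
  have h2 : ∀ {E : Type} [NormedAddCommGroup E] (v : α → E), eLpNorm v 2 μ =
      (∫⁻ x, ‖v x‖ₑ ^ (2 : ℝ) ∂μ) ^ (1 / 2 : ℝ) := fun v => by
    rw [eLpNorm_eq_lintegral_rpow_enorm_toReal two_ne_zero ENNReal.ofNat_ne_top]
    simp
  simp only [h2]
  have hfin : ∫⁻ x, ‖D x‖ₑ ^ (2 : ℝ) ∂μ ≠ ∞ := by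
    have := hD.2
    rw [h2] at this
    intro h
    rw [h] at this
    simp at this
  have key : Tendsto (fun i => ∫⁻ x, ‖u i x‖ₑ ^ (2 : ℝ) ∂μ) l (𝓝 (∫⁻ _, 0 ∂μ)) := by
    refine tendsto_lintegral_filter_of_dominated_convergence' (fun x => ‖D x‖ₑ ^ (2 : ℝ)) ?_ ?_
      hfin ?_
    · filter_upwards [hu] with i hi
      exact hi.enorm.pow_const _
    · filter_upwards [hb] with i hi
      filter_upwards [hi] with x hx
      refine ENNReal.rpow_le_rpow ?_ (by norm_num)
      rw [enorm_le_iff_norm_le]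
      exact hx.trans (le_abs_self _)
    · filter_upwards [hlim] with x hx
      have h1 : Tendsto (fun i => ‖u i x‖ₑ ^ (2 : ℝ)) l (𝓝 (‖(0 : ℂ)‖ₑ ^ (2 : ℝ))) :=
        (ENNReal.continuous_rpow_const.tendsto _).comp ((continuous_enorm.tendsto _).comp hx)
      simpa using h1
  rw [lintegral_zero] at key
  have := (ENNReal.continuous_rpow_const (y := (1 / 2 : ℝ))).tendsto 0 |>.comp key
  simpa [Function.comp_def] using this

theorem eLpNorm_fourier_sub {g h : ℝ → ℂ} (hg1 : Integrable g) (hg : MemLp g 2 volume)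
    (hh : MemLp h 2 volume) :
    eLpNorm (𝓕 g - ((𝓕 (hh.toLp h) : Lp ℂ 2 (volume : Measure ℝ)) : ℝ → ℂ)) 2 volume =
      eLpNorm (g - h) 2 volume := by
  have h1 : edist (𝓕 (hg.toLp g) : Lp ℂ 2 (volume : Measure ℝ)) (𝓕 (hh.toLp h)) =
      edist (hg.toLp g) (hh.toLp h) :=
    (Lp.fourierTransformₗᵢ ℝ ℂ).isometry.edist_eq (hg.toLp g) (hh.toLp h)
  rw [Lp.edist_toLp_toLp g h hg hh, Lp.edist_def] at h1
  rw [← h1]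
  exact eLpNorm_congr_ae ((fourier_toLp_ae_eq hg1 hg).symm.sub (EventuallyEq.refl _ _))

theorem map_mul_right_volume {b : ℝ} (hb : b ≠ 0) :
    Measure.map (fun x : ℝ => x * b) volume = ENNReal.ofReal |b⁻¹| • volume :=
  Real.map_volume_mul_right hb

theorem eLpNorm_comp_mul_right (Φ : ℝ → ℂ) {b : ℝ} (hb : b ≠ 0) :
    eLpNorm (fun x => Φ (x * b)) 2 volume =
      ENNReal.ofReal |b⁻¹| ^ (1 / 2 : ℝ≥0∞).toReal * eLpNorm Φ 2 volume := by
  have h := (measurableEmbedding_mulRight₀ hb).eLpNorm_map_measure (g := Φ) (p := 2)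
    (μ := volume)
  rw [map_mul_right_volume hb, eLpNorm_smul_measure_of_ne_zero (by simpa using hb)] at h
  exact h.symm

theorem memLp_comp_mul_right {Φ : ℝ → ℂ} (hΦ : MemLp Φ 2 volume) {b : ℝ} (hb : b ≠ 0) :
    MemLp (fun x => Φ (x * b)) 2 volume := by
  refine MemLp.comp_of_map (f := fun x : ℝ => x * b) ?_ (by fun_prop)
  rw [map_mul_right_volume hb]
  exact hΦ.smul_measure ENNReal.ofReal_ne_top

end L2

/-! ### The substitution t = e^(-u): Mellin transforms as Fourier transforms. -/

section ExponentialChange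

theorem integrable_exp_neg_smul_iff {E : Type*} [NormedAddCommGroup E] [NormedSpace ℝ E]
    {g : ℝ → E} :
    Integrable (fun u : ℝ => Real.exp (-u) • g (Real.exp (-u))) ↔ IntegrableOn g (Ioi 0) := by
  have himg : (fun u : ℝ => Real.exp (-u)) '' univ = Ioi 0 := by
    ext x
    simp only [image_univ, mem_range, mem_Ioi]
    constructor
    · rintro ⟨u, rfl⟩
      exact Real.exp_pos _
    · exact fun hx => ⟨-Real.log x, by rw [neg_neg, Real.exp_log hx]⟩
  have hd : ∀ u ∈ (univ : Set ℝ),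
      HasDerivWithinAt (fun u : ℝ => Real.exp (-u)) (-Real.exp (-u)) univ u := fun u _ => by
    have := (hasDerivAt_neg u).exp
    rw [mul_neg_one] at this
    exact this.hasDerivWithinAt
  have hinj : InjOn (fun u : ℝ => Real.exp (-u)) univ := fun x _ y _ h => by
    simpa using h
  have h := integrableOn_image_iff_integrableOn_abs_deriv_smul MeasurableSet.univ hd hinj g
  rw [himg, integrableOn_univ] at h
  rw [h]
  simp

/-- The exponential pull-back `u ↦ e^(-σu) k(e^(-u))` of a function on `(0, ∞)`. -/
noncomputable def expPullback (σ : ℝ) (k : ℝ → ℂ) (u : ℝ) : ℂ :=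
  Real.exp (-σ * u) • k (Real.exp (-u))

theorem mellin_eq_fourier_expPullback (k : ℝ → ℂ) (s : ℂ) :
    mellin k s = 𝓕 (expPullback s.re k) (s.im / (2 * Real.pi)) :=
  mellin_eq_fourier k

theorem stronglyMeasurable_expPullback {k : ℝ → ℂ} (hk : StronglyMeasurable k) (σ : ℝ) :
    StronglyMeasurable (expPullback σ k) :=
  (by fun_prop : Continuous fun u : ℝ => Real.exp (-σ * u)).stronglyMeasurable.smul
    (hk.comp_measurable (by fun_prop))

theorem integrable_expPullback {k : ℝ → ℂ} (σ : ℝ) (h : MellinConvergent k σ) :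
    Integrable (expPullback σ k) := by
  refine (integrable_exp_neg_smul_iff.2 h).congr (Eventually.of_forall fun u => ?_)
  have h1 : ((Real.exp (-u) : ℝ) : ℂ) ^ ((σ : ℂ) - 1) =
      ((Real.exp (-u) ^ (σ - 1) : ℝ) : ℂ) := by
    rw [Complex.ofReal_cpow (Real.exp_pos _).le]
    push_cast
    rfl
  simp only [expPullback, h1, ← Real.exp_mul, Complex.real_smul, smul_eq_mul, ← mul_assoc,
    ← Complex.ofReal_mul, ← Real.exp_add]
  ring_nf

/-- Under t = e^(-u), |e^(-σu)k(e^(-u))|²du becomes t^(2σ-1)|k(t)|²dt; the weight is trivial exactly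
at σ = 1/2. -/
theorem memLp_expPullback {k : ℝ → ℂ} (hk : StronglyMeasurable k) (σ : ℝ)
    (h : IntegrableOn (fun t => t ^ (2 * σ - 1) * ‖k t‖ ^ 2) (Ioi 0)) :
    MemLp (expPullback σ k) 2 volume := by
  rw [memLp_two_iff_integrable_sq_norm (stronglyMeasurable_expPullback hk σ).aestronglyMeasurable]
  refine (integrable_exp_neg_smul_iff.2 h).congr (Eventually.of_forall fun u => ?_)
  simp only [expPullback, norm_smul, Real.norm_eq_abs, abs_of_pos (Real.exp_pos _), mul_pow,
    ← Real.exp_mul, smul_eq_mul, ← mul_assoc, ← Real.exp_add, ← Real.exp_nat_mul]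
  push_cast
  ring_nf

theorem memLp_expPullback_half {k : ℝ → ℂ} (hk : StronglyMeasurable k)
    (h : MemLp k 2 (volume.restrict (Ioi 0))) : MemLp (expPullback (1 / 2) k) 2 volume := by
  refine memLp_expPullback hk _ ?_
  have := (memLp_two_iff_integrable_sq_norm h.1).1 h
  simpa [IntegrableOn] using this

end ExponentialChange

/-! ### Truncated Mellin integrals on the critical line. -/

section Truncation

variable {k : ℝ → ℂ}

/-- The pull-back of the truncation of `k` to `(1/T, T)`. -/
noncomputable def truncatedPullback (k : ℝ → ℂ) (T : ℝ) : ℝ → ℂ :=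
  expPullback (1 / 2) ((Ioo T⁻¹ T).indicator k)

theorem truncatedPullback_eq (k : ℝ → ℂ) (T : ℝ) :
    truncatedPullback k T =
      ((fun u => Real.exp (-u)) ⁻¹' Ioo T⁻¹ T).indicator (expPullback (1 / 2) k) := by
  funext u
  by_cases h : Real.exp (-u) ∈ Ioo T⁻¹ T
  · rw [indicator_of_mem (s := (fun u => Real.exp (-u)) ⁻¹' Ioo T⁻¹ T) h, truncatedPullback,
      expPullback, expPullback, indicator_of_mem h]
  · rw [indicator_of_notMem (s := (fun u => Real.exp (-u)) ⁻¹' Ioo T⁻¹ T) h, truncatedPullback,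
      expPullback, indicator_of_notMem h, smul_zero]

theorem measurableSet_truncation (T : ℝ) :
    MeasurableSet ((fun u : ℝ => Real.exp (-u)) ⁻¹' Ioo T⁻¹ T) :=
  (by fun_prop : Measurable fun u : ℝ => Real.exp (-u)) measurableSet_Ioo

theorem memLp_truncatedPullback (h : MemLp (expPullback (1 / 2) k) 2 volume) (T : ℝ) :
    MemLp (truncatedPullback k T) 2 volume := by
  rw [truncatedPullback_eq]
  exact h.indicator (measurableSet_truncation T)

theorem integrable_truncatedPullback (h : MemLp (expPullback (1 / 2) k) 2 volume) {T : ℝ}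
    (hT : 0 < T) : Integrable (truncatedPullback k T) := by
  rw [truncatedPullback_eq, integrable_indicator_iff (measurableSet_truncation T)]
  have hsub : (fun u : ℝ => Real.exp (-u)) ⁻¹' Ioo T⁻¹ T ⊆ Ioo (-Real.log T) (Real.log T) := by
    intro u hu
    have h1 := (Real.log_lt_log (inv_pos.2 hT) hu.1)
    have h2 := (Real.log_lt_log (Real.exp_pos _) hu.2)
    rw [Real.log_exp] at h1 h2
    rw [Real.log_inv] at h1
    exact ⟨by linarith, by linarith⟩
  have : IntegrableOn (expPullback (1 / 2) k) (Ioo (-Real.log T) (Real.log T)) := by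
    have : IsFiniteMeasure (volume.restrict (Ioo (-Real.log T) (Real.log T))) :=
      ⟨by simp⟩
    exact (h.restrict _).integrable (by norm_num)
  exact this.mono_set hsub

/-- The right transform t^(-s) is the usual Mellin kernel at 1-s = 1/2 - iτ, whence the sign and the
factor 1/(2π) in the frequency. -/
theorem integral_Ioo_eq_fourier (k : ℝ → ℂ) {T : ℝ} (hT : 0 < T) (τ : ℝ) :
    ∫ t in Ioo T⁻¹ T, k t * (t : ℂ) ^ (-(1 / 2 + τ * Complex.I) : ℂ) =
      𝓕 (truncatedPullback k T) (τ * (-(2 * Real.pi)⁻¹)) := by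
  have h := mellin_eq_fourier_expPullback ((Ioo T⁻¹ T).indicator k) (1 / 2 - τ * Complex.I)
  have hre : (1 / 2 - τ * Complex.I : ℂ).re = 1 / 2 := by simp
  have him : (1 / 2 - τ * Complex.I : ℂ).im = -τ := by simp
  rw [hre, him] at h
  rw [truncatedPullback, show τ * (-(2 * Real.pi)⁻¹) = -τ / (2 * Real.pi) by ring, ← h, mellin]
  have hsub : Ioo T⁻¹ T ⊆ Ioi 0 := fun t ht => (inv_pos.2 hT).trans ht.1
  rw [← inter_eq_right.2 hsub, ← setIntegral_indicator measurableSet_Ioo, inter_eq_right.2 hsub]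
  refine setIntegral_congr_fun measurableSet_Ioi fun t _ => ?_
  by_cases ht : t ∈ Ioo T⁻¹ T
  · simp only [indicator_of_mem ht, smul_eq_mul]
    rw [mul_comm]
    congr 2
    ring
  · simp [indicator_of_notMem ht]

theorem tendsto_truncatedPullback (h : MemLp (expPullback (1 / 2) k) 2 volume) :
    Tendsto (fun T => eLpNorm (truncatedPullback k T - expPullback (1 / 2) k) 2 volume)
      atTop (𝓝 0) := by
  refine tendsto_eLpNorm_two_of_dominated h.norm
    (Eventually.of_forall fun T => ((memLp_truncatedPullback h T).sub h).1)
    (Eventually.of_forall fun T => Eventually.of_forall fun u => ?_)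
    (Eventually.of_forall fun u => ?_)
  · rw [truncatedPullback_eq, Pi.sub_apply]
    by_cases hu : u ∈ (fun u : ℝ => Real.exp (-u)) ⁻¹' Ioo T⁻¹ T
    · rw [indicator_of_mem hu, sub_self, norm_zero]
      exact norm_nonneg _
    · rw [indicator_of_notMem hu, zero_sub, norm_neg]
  · refine tendsto_const_nhds.congr' ?_
    have h1 : ∀ᶠ T : ℝ in atTop, T⁻¹ < Real.exp (-u) :=
      tendsto_inv_atTop_zero.eventually (gt_mem_nhds (Real.exp_pos _))
    filter_upwards [h1, eventually_gt_atTop (Real.exp (-u))] with T hT1 hT2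
    have hu : u ∈ (fun u : ℝ => Real.exp (-u)) ⁻¹' Ioo T⁻¹ T := ⟨hT1, hT2⟩
    rw [truncatedPullback_eq, Pi.sub_apply, indicator_of_mem hu, sub_self]

end Truncation

/-! ### Identification with the right Mellin transform on the critical line. -/

theorem stronglyMeasurable_coe (f : K) : StronglyMeasurable (f : ℝ → ℂ) :=
  Lp.stronglyMeasurable f

theorem memLp_expPullback_coe (f : K) : MemLp (expPullback (1 / 2) f) 2 volume :=
  memLp_expPullback_half (stronglyMeasurable_coe f) (memLp_coe f)

/-- The `L²` Mellin transform of `f`, as a Fourier transform. -/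
noncomputable def fourierPullback (f : K) : Lp ℂ 2 (volume : Measure ℝ) :=
  𝓕 ((memLp_expPullback_coe f).toLp _)

theorem neg_two_pi_inv_ne_zero : (-(2 * Real.pi)⁻¹ : ℝ) ≠ 0 := by
  have := Real.pi_pos
  exact neg_ne_zero.2 (by positivity)

/-- A function whose restriction to the critical line is given by the Fourier transform of the
exponential pull-back of `f` restricts to the right Mellin transform of `f`. -/
theorem isMellinTransform_of_ae_eq (f : K) {G : ℂ → ℂ}
    (h : (fun ξ : ℝ => G (1 / 2 + ((ξ * (-(2 * Real.pi)) : ℝ) : ℂ) * Complex.I)) =ᵐ[volume]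
      fourierPullback f) : IsMellinTransform f G := by
  set Φ : ℝ → ℂ := fun ξ : ℝ => G (1 / 2 + ((ξ * (-(2 * Real.pi)) : ℝ) : ℂ) * Complex.I) with hΦ
  have hG : ∀ τ : ℝ, G (1 / 2 + τ * Complex.I) = Φ (τ * (-(2 * Real.pi)⁻¹)) := fun τ => by
    have : τ * (-(2 * Real.pi)⁻¹) * (-(2 * Real.pi)) = τ := by
      field_simp
    rw [hΦ]
    simp only [this]
  have hΦ2 : MemLp Φ 2 volume := (Lp.memLp (fourierPullback f)).ae_eq h.symm
  refine ⟨?_, ?_⟩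
  · simp only [hG]
    exact memLp_comp_mul_right hΦ2 neg_two_pi_inv_ne_zero
  · have hfp := memLp_expPullback_coe f
    have h1 : ∀ᶠ T : ℝ in atTop, ENNReal.ofReal |(-(2 * Real.pi)⁻¹)⁻¹| ^ (1 / 2 : ℝ≥0∞).toReal *
        eLpNorm (truncatedPullback f T - expPullback (1 / 2) f) 2 volume =
        eLpNorm (fun τ : ℝ => G (1 / 2 + τ * Complex.I) -
          ∫ t in Ioo T⁻¹ T, (f : ℝ → ℂ) t * (t : ℂ) ^ (-(1 / 2 + τ * Complex.I) : ℂ)) 2 volume := by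
      filter_upwards [eventually_gt_atTop 0] with T hT
      simp only [hG, integral_Ioo_eq_fourier _ hT]
      rw [eLpNorm_comp_mul_right (fun ξ => Φ ξ - 𝓕 (truncatedPullback f T) ξ)
        neg_two_pi_inv_ne_zero, ← eLpNorm_fourier_sub (integrable_truncatedPullback hfp hT)
          (memLp_truncatedPullback hfp T) hfp, eLpNorm_sub_comm]
      congr 1
      exact eLpNorm_congr_ae (h.symm.sub (EventuallyEq.refl _ _))
    refine Tendsto.congr' h1 ?_
    have h2 := ENNReal.Tendsto.const_mul (a := ENNReal.ofReal |(-(2 * Real.pi)⁻¹)⁻¹| ^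
      (1 / 2 : ℝ≥0∞).toReal) (tendsto_truncatedPullback hfp) (Or.inr
        (ENNReal.rpow_ne_top_of_nonneg ENNReal.toReal_nonneg ENNReal.ofReal_ne_top))
    simpa using h2

/-- The right Mellin transform is determined almost everywhere on the critical line. -/
theorem IsMellinTransform.ae_eq {f : K} {F G : ℂ → ℂ} (hF : IsMellinTransform f F)
    (hG : IsMellinTransform f G) :
    ∀ᵐ τ : ℝ, F (1 / 2 + τ * Complex.I) = G (1 / 2 + τ * Complex.I) := by
  set I : ℝ → ℝ → ℂ := fun T τ =>
    ∫ t in Ioo T⁻¹ T, (f : ℝ → ℂ) t * (t : ℂ) ^ (-(1 / 2 + τ * Complex.I) : ℂ) with hI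
  have hfp := memLp_expPullback_coe f
  have hIm : ∀ T : ℝ, 0 < T → AEStronglyMeasurable (I T) volume := fun T hT => by
    have hc : Continuous (𝓕 (truncatedPullback f T)) :=
      VectorFourier.fourierIntegral_continuous Real.continuous_fourierChar
        (by exact continuous_inner) (integrable_truncatedPullback hfp hT)
    have : I T = fun τ => 𝓕 (truncatedPullback f T) (τ * (-(2 * Real.pi)⁻¹)) :=
      funext fun τ => integral_Ioo_eq_fourier _ hT τ
    rw [this]
    exact (hc.comp (continuous_mul_const _)).aestronglyMeasurable
  have h0 : eLpNorm (fun τ : ℝ => F (1 / 2 + τ * Complex.I) - G (1 / 2 + τ * Complex.I)) 2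
      volume = 0 := by
    have hsum := hF.2.add hG.2
    rw [add_zero] at hsum
    -- The norm of F - G does not depend on T and is at most the sum of the two distances to the
    -- truncated integral, which tends to 0.
    refine le_antisymm (ge_of_tendsto hsum ?_) zero_le
    filter_upwards [eventually_gt_atTop 0] with T hT
    have e : (fun τ : ℝ => F (1 / 2 + τ * Complex.I) - G (1 / 2 + τ * Complex.I)) =
        (fun τ : ℝ => F (1 / 2 + τ * Complex.I) - I T τ) -
          (fun τ : ℝ => G (1 / 2 + τ * Complex.I) - I T τ) := by
      funext τ
      simp
    rw [e]
    exact eLpNorm_sub_le (hF.1.1.sub (hIm T hT)) (hG.1.1.sub (hIm T hT)) (by norm_num)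
  filter_upwards [(eLpNorm_eq_zero_iff (hF.1.1.sub hG.1.1) two_ne_zero).1 h0] with τ hτ
  exact sub_eq_zero.1 hτ

variable {a : ℝ} {f : K}

theorem integrableOn_Ioc_cpow (ha : 0 < a) {s : ℂ} (hs : s.re < 1) :
    IntegrableOn (fun t : ℝ => (t : ℂ) ^ (-s)) (Ioc 0 a) := by
  have := intervalIntegral.intervalIntegrable_cpow' (a := 0) (b := a) (r := -s) (by simpa using hs)
  rwa [intervalIntegrable_iff_integrableOn_Ioc_of_le ha.le] at this

theorem ae_eq_const_Ioc {c : ℂ}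
    (hc : ∀ᵐ t ∂(volume.restrict (Ioo (0 : ℝ) a)), (f : ℝ → ℂ) t = c) :
    ∀ᵐ t ∂(volume.restrict (Ioc (0 : ℝ) a)), (f : ℝ → ℂ) t = c := by
  rwa [restrict_Ioo_eq_restrict_Ioc] at hc

/-- The integral is split at a: near 0 the constant gives c·a^(1-s)/(1-s), convergent for Re s < 1,
and the tail needs Re s > 1/2. In this strip the continuation is a genuine Mellin integral of `f`.
-/
theorem hasMellin_one_sub (ha : 0 < a) (hf : f ∈ L a) {s : ℂ} (hs : 1 / 2 < s.re)
    (hs' : s.re < 1) : HasMellin (f : ℝ → ℂ) (1 - s) (mellinContinuation f s) := by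
  obtain ⟨c, hc⟩ := hf.1
  have hs1 : s ≠ 1 := by
    rintro rfl
    simp at hs'
  have hc' := ae_eq_const_Ioc hc
  have hae : (fun t : ℝ => c * (t : ℂ) ^ (-s)) =ᵐ[volume.restrict (Ioc (0 : ℝ) a)]
      fun t => (f : ℝ → ℂ) t * (t : ℂ) ^ (-s) := by
    filter_upwards [hc'] with t ht
    rw [ht]
  have i1 : IntegrableOn (fun t : ℝ => (f : ℝ → ℂ) t * (t : ℂ) ^ (-s)) (Ioc 0 a) :=
    ((integrableOn_Ioc_cpow ha hs').const_mul c).congr hae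
  have i2 := integrableOn_mul_cpow (memLp_coe f) ha hs
  have e : ∀ t : ℝ, (t : ℂ) ^ ((1 - s) - 1) • (f : ℝ → ℂ) t = (f : ℝ → ℂ) t * (t : ℂ) ^ (-s) :=
    fun t => by rw [smul_eq_mul, mul_comm]; congr 2; ring
  refine ⟨?_, ?_⟩
  · rw [MellinConvergent]
    simp only [e]
    have := i1.union i2
    rwa [Ioc_union_Ioi_eq_Ioi ha.le] at this
  · rw [mellin]
    simp only [e]
    have hu := setIntegral_union (Ioc_disjoint_Ioi le_rfl) measurableSet_Ioi i1 i2
    rw [Ioc_union_Ioi_eq_Ioi ha.le] at hu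
    rw [hu, mellinContinuation_of_half_lt_re ha hc hs hs1, tailMellin, add_comm]
    congr 1
    have hne : -s + 1 ≠ 0 := by
      rw [neg_add_eq_sub]
      exact sub_ne_zero.2 hs1.symm
    rw [← integral_congr_ae hae, integral_const_mul, ← intervalIntegral.integral_of_le ha.le,
      integral_cpow (Or.inl (by simpa using hs')), Complex.ofReal_zero, Complex.zero_cpow hne,
      sub_zero, neg_add_eq_sub, mul_div_assoc]

/-- At σ = 1/4 the weight is t^(-1/2): integrable near 0, where `f` is constant, and bounded on (a,
∞). It serves to dominate the pull-backs with 1/4 ≤ σ ≤ 1/2. -/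
theorem memLp_expPullback_quarter (ha : 0 < a) (hf : f ∈ L a) :
    MemLp (expPullback (1 / 4) f) 2 volume := by
  obtain ⟨c, hc⟩ := hf.1
  refine memLp_expPullback (stronglyMeasurable_coe f) _ ?_
  have i1 : IntegrableOn (fun t : ℝ => t ^ (2 * (1 / 4) - 1 : ℝ) * ‖(f : ℝ → ℂ) t‖ ^ 2)
      (Ioc 0 a) := by
    have h1 : IntegrableOn (fun t : ℝ => t ^ (2 * (1 / 4) - 1 : ℝ)) (Ioc 0 a) := by
      have := intervalIntegral.intervalIntegrable_rpow' (a := 0) (b := a)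
        (r := (2 * (1 / 4) - 1 : ℝ)) (by norm_num)
      rwa [intervalIntegrable_iff_integrableOn_Ioc_of_le ha.le] at this
    refine (h1.mul_const (‖c‖ ^ 2)).congr ?_
    filter_upwards [ae_eq_const_Ioc hc] with t ht
    rw [ht]
  have i2 : IntegrableOn (fun t : ℝ => t ^ (2 * (1 / 4) - 1 : ℝ) * ‖(f : ℝ → ℂ) t‖ ^ 2)
      (Ioi a) := by
    have h2 := (memLp_two_iff_integrable_sq_norm (memLp_Ioi (memLp_coe f) ha).1).1
      (memLp_Ioi (memLp_coe f) ha)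
    refine (h2.const_mul (a ^ (2 * (1 / 4) - 1 : ℝ))).mono' ?_ ?_
    · exact (measurable_id.pow_const _).aestronglyMeasurable.mul
        ((memLp_Ioi (memLp_coe f) ha).1.norm.pow 2)
    · filter_upwards [ae_restrict_mem measurableSet_Ioi] with t ht
      have hat : a < t := ht
      have ht0 : 0 < t := ha.trans hat
      rw [Real.norm_eq_abs, abs_of_nonneg (by positivity)]
      refine mul_le_mul_of_nonneg_right ?_ (by positivity)
      exact Real.rpow_le_rpow_of_nonpos ha hat.le (by norm_num)
  have := i1.union i2
  rwa [Ioc_union_Ioi_eq_Ioi ha.le] at this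

theorem norm_expPullback_le {σ : ℝ} (h1 : 1 / 4 ≤ σ) (h2 : σ ≤ 1 / 2) (k : ℝ → ℂ) (u : ℝ) :
    ‖expPullback σ k u‖ ≤ ‖expPullback (1 / 4) k u‖ + ‖expPullback (1 / 2) k u‖ := by
  simp only [expPullback, norm_smul, Real.norm_eq_abs, Real.abs_exp]
  rw [← add_mul]
  refine mul_le_mul_of_nonneg_right ?_ (norm_nonneg _)
  rcases le_total 0 u with h | h
  · exact (Real.exp_le_exp.2 (by nlinarith)).trans (le_add_of_nonneg_right (Real.exp_pos _).le)
  · exact (Real.exp_le_exp.2 (by nlinarith)).trans (le_add_of_nonneg_left (Real.exp_pos _).le)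

/-- The meromorphic continuation restricts to the right Mellin transform on the critical line. -/
theorem isMellinTransform_mellinContinuation (ha : 0 < a) (hf : f ∈ L a) :
    IsMellinTransform f (mellinContinuation f) := by
  apply isMellinTransform_of_ae_eq
  have hfp := memLp_expPullback_coe f
  have hq := memLp_expPullback_quarter ha hf
  -- The shift by 5 keeps 1/2+ε below 1 and the pull-back exponent 1/2-ε at least 1/4.
  set ε : ℕ → ℝ := fun n => 1 / (n + 5 : ℝ) with hε
  have hε0 : ∀ n, 0 < ε n := fun n => by positivity
  have hε1 : ∀ n, ε n ≤ 1 / 4 := fun n => by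
    have : (0 : ℝ) ≤ n := Nat.cast_nonneg n
    exact one_div_le_one_div_of_le (by norm_num) (by linarith)
  have hεlim : Tendsto ε atTop (𝓝 0) := by
    refine tendsto_const_nhds.div_atTop ?_
    exact tendsto_atTop_add_const_right _ _ tendsto_natCast_atTop_atTop
  set v : ℕ → ℝ → ℂ := fun n => expPullback (1 / 2 - ε n) f with hv
  have hvb : ∀ n u, ‖v n u‖ ≤ ‖expPullback (1 / 4) f u‖ + ‖expPullback (1 / 2) f u‖ := fun n u =>
    norm_expPullback_le (by linarith [hε1 n]) (by linarith [hε0 n]) _ u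
  have hvm : ∀ n, AEStronglyMeasurable (v n) volume := fun n =>
    (stronglyMeasurable_expPullback (stronglyMeasurable_coe f) _).aestronglyMeasurable
  have hv2 : ∀ n, MemLp (v n) 2 volume := fun n =>
    (hq.norm.add hfp.norm).mono (hvm n) (Eventually.of_forall fun u =>
      (hvb n u).trans (le_abs_self _))
  have hline : ∀ (n : ℕ) (ξ : ℝ), HasMellin (f : ℝ → ℂ)
      (1 - (1 / 2 + ε n + ((ξ * (-(2 * Real.pi)) : ℝ) : ℂ) * Complex.I))
      (mellinContinuation f (1 / 2 + ε n + ((ξ * (-(2 * Real.pi)) : ℝ) : ℂ) * Complex.I)) :=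
    fun n ξ => by
      have hre : (1 / 2 + ε n + ((ξ * (-(2 * Real.pi)) : ℝ) : ℂ) * Complex.I).re =
          1 / 2 + ε n := by simp
      refine hasMellin_one_sub ha hf ?_ ?_ <;> rw [hre] <;> linarith [hε0 n, hε1 n]
  have hv1 : ∀ n, Integrable (v n) := fun n => by
    refine integrable_expPullback _ ?_
    convert! (hline n 0).1 using 1
    push_cast
    ring
  have hvF : ∀ n ξ, 𝓕 (v n) ξ =
      mellinContinuation f (1 / 2 + ε n + ((ξ * (-(2 * Real.pi)) : ℝ) : ℂ) * Complex.I) :=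
    fun n ξ => by
      have hre : (1 - (1 / 2 + ε n + ((ξ * (-(2 * Real.pi)) : ℝ) : ℂ) * Complex.I)).re =
          1 / 2 - ε n := by simp; ring
      have him : (1 - (1 / 2 + ε n + ((ξ * (-(2 * Real.pi)) : ℝ) : ℂ) * Complex.I)).im /
          (2 * Real.pi) = ξ := by simp
      rw [← (hline n ξ).2, mellin_eq_fourier_expPullback, hre, him]
  have hlim : Tendsto (fun n => eLpNorm (v n - expPullback (1 / 2) f) 2 volume) atTop (𝓝 0) := by
    refine tendsto_eLpNorm_two_of_dominated ((hq.norm.add hfp.norm).add hfp.norm)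
      (Eventually.of_forall fun n => ((hv2 n).sub hfp).1)
      (Eventually.of_forall fun n => Eventually.of_forall fun u => ?_)
      (Eventually.of_forall fun u => ?_)
    · exact (norm_sub_le _ _).trans (add_le_add (hvb n u) le_rfl)
    · have hc : Continuous fun x : ℝ => expPullback (1 / 2 - x) f u - expPullback (1 / 2) f u := by
        unfold expPullback
        fun_prop
      have := (hc.tendsto 0).comp hεlim
      simpa [Function.comp_def, hv] using this
  have hlimF : Tendsto (fun n => eLpNorm (𝓕 (v n) - (fourierPullback f : ℝ → ℂ)) 2 volume) atTop
      (𝓝 0) := by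
    refine hlim.congr fun n => ?_
    rw [fourierPullback, eLpNorm_fourier_sub (hv1 n) (hv2 n) hfp]
  have hFm : ∀ n, AEStronglyMeasurable (𝓕 (v n)) volume := fun n =>
    (VectorFourier.fourierIntegral_continuous Real.continuous_fourierChar
      (by exact continuous_inner) (hv1 n)).aestronglyMeasurable
  -- L² convergence gives almost-everywhere convergence along a subsequence; the pointwise limit is
  -- also the continuation on the critical line, by continuity there.
  obtain ⟨ns, hns, hae⟩ := (tendstoInMeasure_of_tendsto_eLpNorm two_ne_zero hFm
    (Lp.memLp (fourierPullback f)).1 hlimF).exists_seq_tendsto_ae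
  filter_upwards [hae] with ξ hξ
  refine tendsto_nhds_unique ?_ hξ
  simp only [hvF]
  have hne : (1 / 2 + ((ξ * (-(2 * Real.pi)) : ℝ) : ℂ) * Complex.I) ≠ 1 := fun h => by
    have := congrArg Complex.re h
    simp at this
  have hcont := (analyticAt_mellinContinuation ha hf hne).continuousAt
  refine hcont.tendsto.comp ?_
  have h1 : Tendsto (fun n => ((ε (ns n) : ℝ) : ℂ)) atTop (𝓝 ((0 : ℝ) : ℂ)) :=
    (Complex.continuous_ofReal.tendsto 0).comp (hεlim.comp hns.tendsto_atTop)
  have h2 := (h1.const_add (1 / 2)).add_const (((ξ * (-(2 * Real.pi)) : ℝ) : ℂ) * Complex.I)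
  simpa using h2

/-! ### Uniqueness and transfer of the bounds. -/

/-- Punctured open neighbourhoods of τ = 0 have positive measure, so zeros of F - G accumulate at
1/2. The order there is infinite, and for a function meromorphic on the whole plane it is then
infinite everywhere. -/
theorem eventuallyEq_of_ae_eq_line {F G : ℂ → ℂ} (hF : Meromorphic F) (hG : Meromorphic G)
    (h : ∀ᵐ τ : ℝ, F (1 / 2 + τ * Complex.I) = G (1 / 2 + τ * Complex.I)) (s : ℂ) :
    F =ᶠ[𝓝[≠] s] G := by
  have hD : Meromorphic (F - G) := fun z => (hF z).sub (hG z)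
  have hfreq : ∃ᶠ z in 𝓝[≠] (1 / 2 : ℂ), (F - G) z = 0 := by
    have hmap : Tendsto (fun τ : ℝ => (1 / 2 + τ * Complex.I : ℂ)) (𝓝[≠] 0) (𝓝[≠] (1 / 2)) := by
      refine tendsto_nhdsWithin_of_tendsto_nhds_of_eventually_within _ ?_ ?_
      · have hc : Continuous fun τ : ℝ => (1 / 2 + τ * Complex.I : ℂ) := by fun_prop
        have := hc.tendsto 0
        simp only [Complex.ofReal_zero, zero_mul, add_zero] at this
        exact this.mono_left nhdsWithin_le_nhds
      · filter_upwards [self_mem_nhdsWithin] with τ hτ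
        have : (τ : ℂ) ≠ 0 := by exact_mod_cast hτ
        simpa using this
    refine hmap.frequently ?_
    rw [frequently_iff]
    intro U hU
    obtain ⟨V, hV, hVU⟩ := mem_nhdsWithin_iff_exists_mem_nhds_inter.1 hU
    obtain ⟨W, hWV, hWo, hW0⟩ := mem_nhds_iff.1 hV
    have hpos : 0 < volume (W ∩ {0}ᶜ) :=
      (hWo.inter isOpen_compl_singleton).measure_pos volume (by
        have : (W ∩ {0}ᶜ) ∈ 𝓝[≠] (0 : ℝ) :=
          inter_mem (mem_nhdsWithin_of_mem_nhds (hWo.mem_nhds hW0)) self_mem_nhdsWithin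
        exact (NeBot.nonempty_of_mem inferInstance this))
    obtain ⟨τ, hτ, hτ'⟩ := (frequently_ae_mem_iff.2 hpos.ne').and_eventually h |>.exists
    exact ⟨τ, hVU ⟨hWV hτ.1, hτ.2⟩, sub_eq_zero.2 hτ'⟩
  have htop : meromorphicOrderAt (F - G) (1 / 2) = ⊤ := by
    by_contra hne
    exact hfreq ((meromorphicOrderAt_ne_top_iff_eventually_ne_zero (hD _)).1 hne)
  have hs : meromorphicOrderAt (F - G) s = ⊤ := by
    by_contra hne
    exact hD.exists_meromorphicOrderAt_ne_top_iff_forall.1 ⟨s, hne⟩ _ htop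
  filter_upwards [meromorphicOrderAt_eq_top_iff.1 hs] with z hz
  exact sub_eq_zero.1 hz

/-- The L-Property only depends on the values of a function away from its poles. -/
theorem LProperty.congr {F G : ℂ → ℂ} (hG : LProperty G) (hF : IsMeromorphicFunction F)
    (h : ∀ s, F =ᶠ[𝓝[≠] s] G) : LProperty F := by
  have hpoles : poles F = poles G := by
    ext s
    simp only [poles, Set.mem_ofPred_eq, meromorphicOrderAt_congr (h s)]
  -- Off the common poles both functions are continuous, so equality on a punctured neighbourhood
  -- extends to its centre.
  have heq : ∀ s, s ∉ poles F → F s = G s := fun s hs =>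
    (((hF.2 s hs).continuousAt.eventuallyEq_nhds_iff_eventuallyEq_nhdsNE
      (hG.1.2 s (hpoles ▸ hs)).continuousAt).1 (h s)).eq_of_nhds
  refine ⟨hF, hpoles ▸ hG.2.1, fun α β ε δ hαβ hε hδ => ?_⟩
  obtain ⟨C, hC⟩ := hG.2.2 α β ε δ hαβ hε hδ
  refine ⟨C, fun s h1 h2 h3 => ?_⟩
  rw [heq s fun hs => by
    have := h3 s hs
    rw [sub_self, norm_zero] at this
    linarith]
  exact hC s h1 h2 (hpoles ▸ h3)

end Sonine

theorem mainTheorem12 (a : ℝ) (ha : 0 < a) :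
    (∀ f ∈ Sonine.L a, ∃ G ∈ Sonine.mellinImage a, Sonine.IsMellinTransform f G) ∧
    ∀ G ∈ Sonine.mellinImage a,
      Sonine.LProperty G ∧
      (∀ σ : ℝ, 1 / 2 ≤ σ → Sonine.lindelofExponent G σ ≤ 0) ∧
      (∀ σ : ℝ, σ ≤ 1 / 2 → Sonine.lindelofExponent G σ ≤ ((1 / 2 - σ : ℝ) : EReal)) := by
  refine ⟨fun f hf => ?_, ?_⟩
  · have h := Sonine.isMellinTransform_mellinContinuation ha hf
    exact ⟨_, ⟨Sonine.isMeromorphicFunction_mellinContinuation ha hf, f, hf, h⟩, h⟩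
  · rintro G ⟨hG, f, hf, hfG⟩
    have hL : Sonine.LProperty G :=
      (Sonine.lProperty_mellinContinuation ha hf).congr hG (Sonine.eventuallyEq_of_ae_eq_line hG.1
        (Sonine.meromorphic_mellinContinuation ha hf)
        (hfG.ae_eq (Sonine.isMellinTransform_mellinContinuation ha hf)))
    refine ⟨hL, fun σ hσ => ?_, fun σ hσ => ?_⟩
    · have h := hL.lindelofExponent_le σ
      rwa [max_eq_right (by linarith)] at h
    · have h := hL.lindelofExponent_le σ
      rwa [max_eq_left (by linarith)] at h
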